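/- Let $q^s=e^{2\pi i s\tau}$ for $\tau$ in the upper half-plane, let $\eta(\tau)=q^{1/24}\prod_{n\ge1}(1-q^n)$, $E_2(\tau)=1-24\sum_{n\ge1}\bigl(\sum_{d\mid n}d\bigr)q^n$, and put $$E_2^{(2)}(\tau)=2E_2(2\tau)-E_2(\tau),\qquad \Delta_4^{(2)}(\tau)=\frac{\eta(2\tau)^{16}}{\eta(\tau)^8},$$ $$E_1^{(3)}(\tau)=1+6\sum_{n\ge1}\Bigl(\sum_{d\mid n}\Bigl(\frac d3\Bigr)\Bigr)q^n,\qquad \Delta_3^{(3)}(\tau)=\frac{\eta(3\tau)^9}{\eta(\tau)^3},$$ $$E_2^{(4)}(\tau)=\tfrac13\bigl(4E_2(4\tau)-E_2(\tau)\bigr),\qquad \Delta_2^{(4)}(\tau)=\frac{\eta(4\tau)^8}{\eta(2\tau)^4},$$ with the roots $(\Delta_4^{(2)})^{1/2}=\eta(2\tau)^8/\eta(\tau)^4$, $(\Delta_3^{(3)})^{1/3}=\eta(3\tau)^3/\eta(\tau)$, $(\Delta_2^{(4)})^{1/4}=\eta(4\tau)^2/\eta(2\tau)$, whose powers define all fractional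 powers below. Write $(a)_i=a(a+1)\cdots(a+i-1)$. Define $F_k$ as follows. (a) For an integer $k\ge0$ with $k\equiv2\pmod 6$, $$F_k=\sum_{0\le i\le (k-2)/12}\frac{(-\frac{k-2}{12})_i(-\frac{k-8}{12})_i}{(\frac{k+7}6)_i\,i!}\,64^i\,(\Delta_4^{(2)})^{\frac{k+1}6+i}(E_2^{(2)})^{\frac{k-2}6-2i}.$$ (b) For an integer $k\ge0$ with $k\equiv1$ or $3\pmod 6$, $$F_k=\sum_{0\le i\le (k-1)/6}\frac{(-\frac{k-1}{6})_i(-\frac{k-3}{6})_i}{(\frac{k+7}6)_i\,i!}\,27^i\,(\Delta_3^{(3)})^{\frac{k+1}6+i}(E_1^{(3)})^{\frac{k-1}2-3i}.$$ (c) For $k=3n+\frac12$ with an integer $n\ge0$, $$F_k=\sum_{0\le i\le (2k-1)/6}\frac{(-\frac{2k-1}{6})_i(-\frac{k-2}{6})_i}{(\frac{k+7}6)_i\,i!}\,16^i\,(\Delta_2^{(4)})^{\frac{k+1}6+i}(E_2^{(4)})^{\frac{2k-1}6-i}.$$ (These are the known explicit modular solutions with leading term $q^{(k+1)/6}$ of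 the differential equation $f''-\frac{k+1}6E_2f'+\frac{k(k+1)}{12}E_2'f=0$, where $'=\frac1{2\pi i}\frac{d}{d\tau}$.) **Theorem.** In each of the cases (a), (b), (c), $F_k$ has an expansion $F_k(\tau)=\sum_{m\ge0}c_m\,q^{\frac{k+1}6+m}$, convergent on the whole upper half-plane, with $c_0=1$, and its Fourier coefficients are positive: $c_m>0$ for all $m\ge0$, except that for $k=1$ and $k=\frac12$ the claim is $c_m\ge0$ for all $m$ (that is, every non-zero coefficient is positive). Moreover, for every real $\alpha$ with $0\le\alpha<8$, all coefficients of $q^m$, $m\ge0$, in the expansion of $E_2^{(4)}-\alpha\Delta_2^{(4)}$ are strictly positive. -/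

import Mathlib

open scoped UpperHalfPlane

noncomputable section

namespace KanekoKoike

/-- The point `N τ` of the upper half-plane, for an integer `N ≥ 1`. -/
def scale (N : ℕ) (hN : 0 < N) (τ : ℍ) : ℍ :=
  ⟨(N : ℂ) * (τ : ℂ), by
    have h : ((N : ℂ) * (τ : ℂ)).im = (N : ℝ) * τ.im := by simp
    rw [h]
    exact mul_pos (Nat.cast_pos.mpr hN) τ.im_pos⟩

/-- `f(τ) = ∑_{n ≥ 0} c_n q^{r+n}` on the whole upper half-plane, where `q^s = exp(2πi s τ)`. Such a
family of coefficients is uniquely determined by `f` and `r`. -/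
def HasFourierExpansion (f : ℍ → ℂ) (r : ℝ) (c : ℕ → ℝ) : Prop :=
  ∀ τ : ℍ, HasSum
    (fun n : ℕ => (c n : ℂ) * Complex.exp (2 * Real.pi * Complex.I * ((r : ℂ) + n) * (τ : ℂ))) (f τ)

/-- The coefficient `(a)_i (b)_i / ((c)_i i!)` of the Gauss hypergeometric series, as a complex
number. -/
def hypCoeff (a b c : ℝ) (i : ℕ) : ℂ :=
  ((ordinaryHypergeometricCoefficient a b c i : ℝ) : ℂ)

/-! Level 2. -/

/-- `E_2^{(2)}(τ) = 2 E_2(2τ) - E_2(τ)`. -/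
def E22 (τ : ℍ) : ℂ :=
  2 * EisensteinSeries.E2 (scale 2 (by norm_num) τ) - EisensteinSeries.E2 τ

/-- `Δ_4^{(2)}(τ) = η(2τ)^16 / η(τ)^8`. -/
def Delta42 (τ : ℍ) : ℂ :=
  ModularForm.eta (2 * (τ : ℂ)) ^ 16 / ModularForm.eta (τ : ℂ) ^ 8

/-- `Δ_4^{(2)}(τ)^{1/2} = η(2τ)^8 / η(τ)^4 = q^{1/2} + ⋯`. -/
def Delta42Root (τ : ℍ) : ℂ :=
  ModularForm.eta (2 * (τ : ℂ)) ^ 8 / ModularForm.eta (τ : ℂ) ^ 4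

theorem Delta42Root_pow (τ : ℍ) : Delta42Root τ ^ 2 = Delta42 τ := by
  simp only [Delta42Root, Delta42, div_pow, ← pow_mul]

/-- For `k ≡ 2 mod 6`: the sum over `0 ≤ i ≤ (k-2)/12` of
`(-(k-2)/12)_i (-(k-8)/12)_i / (((k+7)/6)_i i!) 64^i (Δ_4^{(2)})^{(k+1)/6+i} (E_2^{(2)})^{(k-2)/6-2i}`,
where `(Δ_4^{(2)})^{(k+1)/6}` is the power `(k+1)/3` of `(Δ_4^{(2)})^{1/2}`. -/
def solTwo (k : ℕ) (τ : ℍ) : ℂ :=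
  ∑ i ∈ Finset.range ((k - 2) / 12 + 1),
    hypCoeff (-((k : ℝ) - 2) / 12) (-((k : ℝ) - 8) / 12) (((k : ℝ) + 7) / 6) i * 64 ^ i *
      (Delta42Root τ ^ ((k + 1) / 3) * Delta42 τ ^ i) * E22 τ ^ ((k - 2) / 6 - 2 * i)

/-! Level 3. -/

/-- `E_1^{(3)}(τ) = 1 + 6 ∑_{n ≥ 1} (∑_{d ∣ n} (d/3)) q^n`, with `(d/3)` the Legendre symbol. -/
def E13 (τ : ℍ) : ℂ :=
  1 + 6 * ∑' n : ℕ, ((∑ d ∈ (n + 1).divisors, legendreSym 3 (d : ℤ) : ℤ) : ℂ) *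
    Complex.exp (2 * Real.pi * Complex.I * ((n : ℂ) + 1) * (τ : ℂ))

/-- `Δ_3^{(3)}(τ) = η(3τ)^9 / η(τ)^3`. -/
def Delta33 (τ : ℍ) : ℂ :=
  ModularForm.eta (3 * (τ : ℂ)) ^ 9 / ModularForm.eta (τ : ℂ) ^ 3

/-- `Δ_3^{(3)}(τ)^{1/3} = η(3τ)^3 / η(τ) = q^{1/3} + ⋯`. -/
def Delta33Root (τ : ℍ) : ℂ :=
  ModularForm.eta (3 * (τ : ℂ)) ^ 3 / ModularForm.eta (τ : ℂ)

theorem Delta33Root_pow (τ : ℍ) : Delta33Root τ ^ 3 = Delta33 τ := by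
  simp only [Delta33Root, Delta33, div_pow, ← pow_mul]

/-- For `k ≡ 1, 3 mod 6`: the sum over `0 ≤ i ≤ (k-1)/6` of
`(-(k-1)/6)_i (-(k-3)/6)_i / (((k+7)/6)_i i!) 27^i (Δ_3^{(3)})^{(k+1)/6+i} (E_1^{(3)})^{(k-1)/2-3i}`,
where `(Δ_3^{(3)})^{(k+1)/6}` is the power `(k+1)/2` of `(Δ_3^{(3)})^{1/3}`. -/
def solThree (k : ℕ) (τ : ℍ) : ℂ :=
  ∑ i ∈ Finset.range ((k - 1) / 6 + 1),
    hypCoeff (-((k : ℝ) - 1) / 6) (-((k : ℝ) - 3) / 6) (((k : ℝ) + 7) / 6) i * 27 ^ i *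
      (Delta33Root τ ^ ((k + 1) / 2) * Delta33 τ ^ i) * E13 τ ^ ((k - 1) / 2 - 3 * i)

/-! Level 4. -/

/-- `E_2^{(4)}(τ) = (4 E_2(4τ) - E_2(τ)) / 3`. -/
def E24 (τ : ℍ) : ℂ :=
  (4 * EisensteinSeries.E2 (scale 4 (by norm_num) τ) - EisensteinSeries.E2 τ) / 3

/-- `Δ_2^{(4)}(τ) = η(4τ)^8 / η(2τ)^4`. -/
def Delta24 (τ : ℍ) : ℂ :=
  ModularForm.eta (4 * (τ : ℂ)) ^ 8 / ModularForm.eta (2 * (τ : ℂ)) ^ 4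

/-- `Δ_2^{(4)}(τ)^{1/4} = η(4τ)^2 / η(2τ) = q^{1/4} + ⋯`. -/
def Delta24Root (τ : ℍ) : ℂ :=
  ModularForm.eta (4 * (τ : ℂ)) ^ 2 / ModularForm.eta (2 * (τ : ℂ))

theorem Delta24Root_pow (τ : ℍ) : Delta24Root τ ^ 4 = Delta24 τ := by
  simp only [Delta24Root, Delta24, div_pow, ← pow_mul]

/-- For `k = 3 n + 1/2`, so that `(2k-1)/6 = n` and `(k+1)/6 = (2n+1)/4`: the sum over
`0 ≤ i ≤ (2k-1)/6` of
`(-(2k-1)/6)_i (-(k-2)/6)_i / (((k+7)/6)_i i!) 16^i (Δ_2^{(4)})^{(k+1)/6+i} (E_2^{(4)})^{(2k-1)/6-i}`,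
where `(Δ_2^{(4)})^{(k+1)/6}` is the power `2n+1` of `(Δ_2^{(4)})^{1/4}`. -/
def solFour (n : ℕ) (τ : ℍ) : ℂ :=
  let k : ℝ := 3 * (n : ℝ) + 1 / 2
  ∑ i ∈ Finset.range (n + 1),
    hypCoeff (-(2 * k - 1) / 6) (-(k - 2) / 6) ((k + 7) / 6) i * 16 ^ i *
      (Delta24Root τ ^ (2 * n + 1) * Delta24 τ ^ i) * E24 τ ^ (n - i)

end KanekoKoike

end

/-! Each `F_k` is a power of a root of Δ times a polynomial in Δ and an Eisenstein series, so
positivity reduces to signs of the Fourier coefficients of these forms and of the hypergeometric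
coefficients.

The roots are expanded explicitly. Kronecker's partial fraction expansion of a quotient of theta
products, and its degenerate case `x * y = 1`, come from finite Lagrange interpolation and a Tannery
limit (`kronecker_identity`, `kronecker_identity_double`). Specialised to `Q = q ^ 2` and `Q = q ^
3` they turn the level 2 and 3 eta quotients into double series: the level 2 root has coefficients
σ(2m+1), and the level 3 root has the sums of the character (d/3) over d ∣ 3m+1, which are
nonnegative but can vanish, while its square has positive coefficients. The level 4 root is Gauss's
triangular number series in q². The Eisenstein series at levels 2 and 4 are positive because Nσ(m) <
σ(Nm); the one at level 3 is nonnegative, again by the character sum.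

At levels 2 and 3 both Pochhammer symbols in the numerator have only nonpositive factors in the
range of summation, so all terms are nonnegative, and one positive factor (the root, respectively
its square) gives strict positivity. For k = 1 only the first power of the level 3 root is present.

At level 4 the hypergeometric coefficients change sign once n ≥ 2. With H = E - 8Δ and w = 8Δ, the
polynomial is rewritten in w and H (`exists_pos_reexpansion`). Its new coefficients are binomials
times moments of (1 - 2X)^j, positive by a three-term recurrence. The series H is nonnegative,
vanishing exactly at odd exponents, where Δ is positive; so the terms of degree 0 and 1 in w
together give all positive coefficients when n ≥ 1. -/

namespace KanekoKoike

/-! ### Finite partial fractions from Lagrange interpolation. -/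

open Finset Filter Topology

/-- Lagrange interpolation at the nodes `Q ^ (-n)`, in product form. -/
theorem prod_eq_sum_interpolation {K : Type*} [Field K] {Q : K} (hQ0 : Q ≠ 0)
    (hQ : ∀ j : ℤ, j ≠ 0 → Q ^ j ≠ 1) (T S : Finset ℤ) (hS : S.card < T.card) (x y : K) :
    ∏ j ∈ S, (1 - x * y * Q ^ j) =
      ∑ n ∈ T, (∏ j ∈ S, (1 - x * Q ^ (j - n))) *
        ∏ j ∈ T.erase n, ((1 - y * Q ^ j) / (1 - Q ^ (j - n))) := by
  classical
  set f : Polynomial K := ∏ j ∈ S, (1 - Polynomial.C (x * Q ^ j) * Polynomial.X) with hf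
  -- In the variable y the left side has degree at most `S.card`, so the nodes indexed by `T`
  -- determine it.
  have hdeg : f.degree < T.card := by
    refine lt_of_le_of_lt (Polynomial.degree_prod_le _ _) ?_
    refine lt_of_le_of_lt (Finset.sum_le_sum (g := fun _ => (1 : WithBot ℕ)) fun j _ => ?_) ?_
    · refine (Polynomial.degree_sub_le _ _).trans (max_le ?_ (Polynomial.degree_C_mul_X_le _))
      exact Polynomial.degree_one_le.trans (by norm_num)
    · rw [Finset.sum_const, nsmul_one]
      exact_mod_cast hS
  have hinj : Set.InjOn (fun n : ℤ => Q ^ (-n)) (T : Set ℤ) := by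
    intro a _ b _ hab
    by_contra hne
    refine hQ (b - a) (by omega) ?_
    have : Q ^ (b - a) = Q ^ (-a) / Q ^ (-b) := by
      rw [← zpow_sub₀ hQ0]; congr 1; ring
    rw [this]
    simp only at hab
    rw [hab, div_self (zpow_ne_zero _ hQ0)]
  have key := congrArg (Polynomial.eval y) (Lagrange.eq_interpolate (f := f) hinj hdeg)
  have e1 : ∀ z : K, f.eval z = ∏ j ∈ S, (1 - x * z * Q ^ j) := by
    intro z
    rw [hf, Polynomial.eval_prod]
    refine Finset.prod_congr rfl fun j _ => ?_
    simp; ring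
  rw [e1, Lagrange.interpolate_apply, Polynomial.eval_finsetSum] at key
  rw [key]
  refine Finset.sum_congr rfl fun n hn => ?_
  rw [Polynomial.eval_mul, Polynomial.eval_C, e1]
  congr 1
  · refine Finset.prod_congr rfl fun j _ => ?_
    rw [sub_eq_add_neg j n, zpow_add₀ hQ0]; ring
  · rw [Lagrange.basis, Polynomial.eval_prod]
    refine Finset.prod_congr rfl fun j hj => ?_
    have hjn : j ≠ n := Finset.ne_of_mem_erase hj
    have h1 : 1 - Q ^ (j - n) ≠ 0 := sub_ne_zero.mpr (hQ _ (by omega)).symm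
    have h3 : Q ^ j ≠ 0 := zpow_ne_zero _ hQ0
    have h4 : Q ^ n ≠ 0 := zpow_ne_zero _ hQ0
    have h2 : Q ^ n - Q ^ j ≠ 0 := by
      rw [zpow_sub₀ hQ0] at h1
      intro h; apply h1
      rw [sub_eq_zero] at h ⊢
      rw [← h, div_self h4]
    simp only [Lagrange.basisDivisor, Polynomial.eval_mul, Polynomial.eval_C, Polynomial.eval_sub,
      Polynomial.eval_X, zpow_neg]
    rw [zpow_sub₀ hQ0] at h1 ⊢
    have h5 : (Q ^ n)⁻¹ - (Q ^ j)⁻¹ ≠ 0 := by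
      rw [inv_sub_inv h4 h3]
      exact div_ne_zero (by rw [← neg_sub]; exact neg_ne_zero.mpr h2) (mul_ne_zero h4 h3)
    rw [eq_div_iff h1, inv_mul_eq_div, div_mul_eq_mul_div, div_eq_iff h5]
    field_simp
    ring

/-- A product over the integers of `[-A, B]`, split at `0`. -/
theorem prod_Icc_neg {M : Type*} [CommMonoid M] (f : ℤ → M) (A B : ℕ) :
    ∏ j ∈ Finset.Icc (-(A : ℤ)) B, f j =
      (∏ m ∈ range A, f (-((m : ℤ) + 1))) * ∏ m ∈ range (B + 1), f m := by
  induction A with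
  | zero =>
    rw [Finset.prod_range_zero, one_mul]
    refine (Finset.prod_bij (fun (m : ℕ) _ => (m : ℤ)) ?_ ?_ ?_ ?_).symm
    · intro a ha; simp at ha ⊢; omega
    · intro a _ b _ h; exact_mod_cast h
    · intro b hb
      simp at hb
      exact ⟨b.toNat, by simp; omega, by omega⟩
    · intro a _; rfl
  | succ A ih =>
    have : Finset.Icc (-((A + 1 : ℕ) : ℤ)) B = insert (-((A : ℤ) + 1)) (Finset.Icc (-(A : ℤ)) B) := by
      ext j; simp only [Finset.mem_Icc, Finset.mem_insert]; push_cast; omega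
    rw [this, Finset.prod_insert (by simp), ih, Finset.prod_range_succ _ A]
    rw [mul_comm (∏ m ∈ range A, _) (f _)]
    simp only [mul_assoc]

theorem prod_Icc_neg_erase {M : Type*} [CommMonoid M] (f : ℤ → M) (A B : ℕ) :
    ∏ j ∈ (Finset.Icc (-(A : ℤ)) B).erase 0, f j =
      (∏ m ∈ range A, f (-((m : ℤ) + 1))) * ∏ m ∈ range B, f ((m : ℤ) + 1) := by
  have h := prod_Icc_neg (fun j => if j = 0 then 1 else f j) A B
  rw [Finset.prod_range_succ'] at h
  simp only [Nat.cast_zero, if_true, mul_one] at h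
  rw [← Finset.mul_prod_erase (Finset.Icc (-(A : ℤ)) B) _ (a := 0) (by simp)] at h
  simp only [if_true, one_mul] at h
  rw [Finset.prod_congr rfl (g := fun j => if j = 0 then 1 else f j) (fun j hj => by
    rw [if_neg (Finset.ne_of_mem_erase hj)]), h]
  refine congrArg₂ (· * ·) (Finset.prod_congr rfl fun m _ => ?_) (Finset.prod_congr rfl fun m _ => ?_)
  · rw [if_neg (by omega)]
  · rw [if_neg (by omega), Nat.cast_add, Nat.cast_one]

end KanekoKoike

namespace KanekoKoike

open Finset Filter Topology

/-- `∏_{m < A} (1 - Q^{m+1}/x) / (1 - Q^{m+1})`. -/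
def leftProd {K : Type*} [Field K] (Q x : K) (A : ℕ) : K :=
  ∏ m ∈ range A, ((1 - x⁻¹ * Q ^ (m + 1)) / (1 - Q ^ (m + 1)))

/-- `∏_{m < B} (1 - x Q^m) / (1 - Q^{m+1})`. -/
def rightProd {K : Type*} [Field K] (Q x : K) (B : ℕ) : K :=
  ∏ m ∈ range B, ((1 - x * Q ^ m) / (1 - Q ^ (m + 1)))

section
variable {K : Type*} [Field K] {Q : K}

theorem prod_Icc_div_prod_erase (hQ0 : Q ≠ 0) (hQ : ∀ j : ℤ, j ≠ 0 → Q ^ j ≠ 1)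
    {x : K} (hx0 : x ≠ 0) (A B : ℕ) :
    (∏ j ∈ Finset.Icc (-(A : ℤ)) B, (1 - x * Q ^ j)) /
      ∏ j ∈ (Finset.Icc (-(A : ℤ)) B).erase 0, (1 - Q ^ j) =
    x ^ A * leftProd Q x A * (rightProd Q x B * (1 - x * Q ^ B)) := by
  have hxA : x ^ A = ∏ m ∈ range A, x := by simp
  rw [prod_Icc_neg, prod_Icc_neg_erase, mul_div_mul_comm, ← Finset.prod_div_distrib,
    Finset.prod_range_succ, mul_div_right_comm, ← Finset.prod_div_distrib, leftProd, hxA,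
    ← Finset.prod_mul_distrib, zpow_natCast, rightProd]
  refine congrArg₂ (· * ·) (Finset.prod_congr rfl fun m _ => ?_)
    (congrArg (· * _) (Finset.prod_congr rfl fun m _ => ?_))
  · have h1 := sub_ne_zero.mpr (hQ (-((m : ℤ) + 1)) (by omega)).symm
    have h2 := sub_ne_zero.mpr (hQ ((m : ℤ) + 1) (by omega)).symm
    have h3 : Q ^ ((m : ℤ) + 1) = Q ^ (m + 1) := by exact_mod_cast zpow_natCast Q (m + 1)
    have h4 : Q ^ (m + 1) ≠ 0 := pow_ne_zero _ hQ0
    rw [zpow_neg, h3] at h1 ⊢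
    rw [h3] at h2
    rw [← mul_div_assoc, div_eq_div_iff h1 h2]
    field_simp
    ring
  · have h3 : Q ^ ((m : ℤ) + 1) = Q ^ (m + 1) := by exact_mod_cast zpow_natCast Q (m + 1)
    rw [h3, zpow_natCast]

theorem prod_erase_ne_zero (hQ : ∀ j : ℤ, j ≠ 0 → Q ^ j ≠ 1) (T : Finset ℤ) (n : ℤ) :
    ∏ j ∈ T.erase n, (1 - Q ^ (j - n)) ≠ 0 := by
  refine Finset.prod_ne_zero_iff.mpr fun j hj => sub_ne_zero.mpr (hQ _ ?_).symm
  have := Finset.ne_of_mem_erase hj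
  omega

/-- Translation by n carries the window [-N, N] to [-(N+n), N-n], whose two halves have different
lengths; this is what the Tannery argument needs. -/
theorem prod_shift_div (hQ0 : Q ≠ 0) (hQ : ∀ j : ℤ, j ≠ 0 → Q ^ j ≠ 1)
    {x : K} (hx0 : x ≠ 0) {N : ℕ} {n : ℤ} (hn : n ∈ Finset.Icc (-(N : ℤ)) N) :
    (∏ j ∈ Finset.Icc (-(N : ℤ)) N, (1 - x * Q ^ (j - n))) /
      ∏ j ∈ (Finset.Icc (-(N : ℤ)) N).erase n, (1 - Q ^ (j - n)) =
    x ^ (N + n) * leftProd Q x (N + n).toNat *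
      (rightProd Q x (N - n).toNat * (1 - x * Q ^ (N - n))) := by
  rw [Finset.mem_Icc] at hn
  obtain ⟨A, hA⟩ := Int.eq_ofNat_of_zero_le (show 0 ≤ (N : ℤ) + n by omega)
  obtain ⟨B, hB⟩ := Int.eq_ofNat_of_zero_le (show 0 ≤ (N : ℤ) - n by omega)
  have h := prod_Icc_div_prod_erase hQ0 hQ hx0 A B
  rw [hA, hB]
  simp only [Int.toNat_natCast, zpow_natCast]
  rw [← h]
  have e : (Finset.Icc (-(A : ℤ)) B) =
      (Finset.Icc (-(N : ℤ)) N).map (Equiv.subRight n).toEmbedding := by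
    ext j
    simp only [Finset.mem_Icc, Finset.mem_map_equiv, Equiv.subRight_symm_apply]
    omega
  have e' : (Finset.Icc (-(A : ℤ)) B).erase 0 =
      ((Finset.Icc (-(N : ℤ)) N).erase n).map (Equiv.subRight n).toEmbedding := by
    ext j
    simp only [Finset.mem_erase, Finset.mem_Icc, Finset.mem_map_equiv, Equiv.subRight_symm_apply]
    omega
  rw [e', e, Finset.prod_map, Finset.prod_map]
  rfl

/-- Partial fractions of `∏_{j ≠ s} (1 - xyQ^j) / ∏_j (1 - yQ^j)`, `|j| ≤ N`, as a function of `y`. -/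
theorem finite_partial_fractions (hQ0 : Q ≠ 0) (hQ : ∀ j : ℤ, j ≠ 0 → Q ^ j ≠ 1)
    {x y : K} (hx0 : x ≠ 0) (hx : ∀ j : ℤ, 1 - x * Q ^ j ≠ 0) (hy : ∀ j : ℤ, 1 - y * Q ^ j ≠ 0)
    (N : ℕ) {s : ℤ} (hs : s ∈ Finset.Icc (-(N : ℤ)) N) :
    (∏ j ∈ (Finset.Icc (-(N : ℤ)) N).erase s, (1 - x * y * Q ^ j)) /
      ∏ j ∈ Finset.Icc (-(N : ℤ)) N, (1 - y * Q ^ j) =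
    ∑ n ∈ Finset.Icc (-(N : ℤ)) N, x ^ (N + n) * leftProd Q x (N + n).toNat *
      (rightProd Q x (N - n).toNat * (1 - x * Q ^ (N - n))) /
        ((1 - x * Q ^ (s - n)) * (1 - y * Q ^ n)) := by
  rw [prod_eq_sum_interpolation hQ0 hQ (Finset.Icc (-(N : ℤ)) N) _
    (Finset.card_erase_lt_of_mem hs), Finset.sum_div]
  refine Finset.sum_congr rfl fun n hn => ?_
  rw [← prod_shift_div hQ0 hQ hx0 hn]
  have h1 := Finset.mul_prod_erase _ (fun j => 1 - x * Q ^ (j - n)) hs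
  have h2 := Finset.mul_prod_erase _ (fun j => 1 - y * Q ^ j) hn
  have h3 : ∏ j ∈ (Finset.Icc (-(N : ℤ)) N).erase n, (1 - y * Q ^ j) ≠ 0 :=
    Finset.prod_ne_zero_iff.mpr fun j _ => hy j
  rw [← h1, ← h2, Finset.prod_div_distrib]
  have := prod_erase_ne_zero hQ (Finset.Icc (-(N : ℤ)) N) n
  have := hx (s - n)
  have := hy n
  field_simp

end

/-- Tannery's theorem for the symmetric sums `∑_{|n| ≤ N} a(N+n) b(N-n) g(n)`. -/
theorem tendsto_sum_Icc_mul {a b : ℕ → ℂ} {la lb : ℂ} (ha : Tendsto a atTop (𝓝 la))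
    (hb : Tendsto b atTop (𝓝 lb)) {g : ℤ → ℂ} (hg : Summable g) :
    Tendsto (fun N : ℕ => ∑ n ∈ Finset.Icc (-(N : ℤ)) N,
      a (N + n).toNat * b (N - n).toNat * g n) atTop (𝓝 (la * lb * ∑' n, g n)) := by
  obtain ⟨Ca, hCa⟩ := ha.norm.bddAbove_range
  obtain ⟨Cb, hCb⟩ := hb.norm.bddAbove_range
  have hCa' : ∀ n, ‖a n‖ ≤ Ca := fun n => hCa ⟨n, rfl⟩
  have hCb' : ∀ n, ‖b n‖ ≤ Cb := fun n => hCb ⟨n, rfl⟩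
  have hCa0 : 0 ≤ Ca := (norm_nonneg _).trans (hCa' 0)
  have hCb0 : 0 ≤ Cb := (norm_nonneg _).trans (hCb' 0)
  rw [← tsum_mul_left]
  have key := tendsto_tsum_of_dominated_convergence
    (f := fun (N : ℕ) (n : ℤ) => if n ∈ Finset.Icc (-(N : ℤ)) N then
      a (N + n).toNat * b (N - n).toNat * g n else 0) (g := fun n => la * lb * g n)
    (bound := fun n => Ca * Cb * ‖g n‖) (𝓕 := atTop) (hg.norm.mul_left _) ?_ ?_
  · refine key.congr fun N => ?_
    rw [tsum_eq_sum (s := Finset.Icc (-(N : ℤ)) N)]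
    · exact Finset.sum_congr rfl fun n hn => by rw [if_pos hn]
    · intro n hn; rw [if_neg hn]
  · intro n
    have t1 : Tendsto (fun N : ℕ => ((N : ℤ) + n).toNat) atTop atTop := by
      refine tendsto_atTop.mpr fun M => ?_
      filter_upwards [eventually_ge_atTop (M + n.natAbs)] with N hN
      omega
    have t2 : Tendsto (fun N : ℕ => ((N : ℤ) - n).toNat) atTop atTop := by
      refine tendsto_atTop.mpr fun M => ?_
      filter_upwards [eventually_ge_atTop (M + n.natAbs)] with N hN
      omega
    refine (((ha.comp t1).mul (hb.comp t2)).mul_const (g n)).congr' ?_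
    filter_upwards [eventually_ge_atTop n.natAbs] with N hN
    rw [if_pos (by rw [Finset.mem_Icc]; omega)]
    rfl
  · refine Eventually.of_forall fun N n => ?_
    split_ifs
    · rw [norm_mul, norm_mul]
      exact mul_le_mul_of_nonneg_right (mul_le_mul (hCa' _) (hCb' _) (norm_nonneg _) hCa0)
        (norm_nonneg _)
    · rw [norm_zero]; positivity

end KanekoKoike

/-! ### Infinite products and Kronecker's identity. -/

namespace KanekoKoike

open Finset Filter Topology

/-- The infinite product `(x; Q)_∞ = ∏_{m ≥ 0} (1 - x Q^m)`. -/
noncomputable def pochInf (x Q : ℂ) : ℂ := ∏' m : ℕ, (1 - x * Q ^ m)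

section
variable {Q : ℂ}

theorem summable_neg_mul_pow (hQ : ‖Q‖ < 1) (x : ℂ) : Summable fun m : ℕ => ‖-(x * Q ^ m)‖ := by
  simp only [norm_neg, norm_mul, norm_pow]
  exact (summable_geometric_of_lt_one (norm_nonneg _) hQ).mul_left _

theorem multipliable_one_sub_mul_pow (hQ : ‖Q‖ < 1) (x : ℂ) :
    Multipliable fun m : ℕ => 1 - x * Q ^ m := by
  simpa only [sub_eq_add_neg] using multipliable_one_add_of_summable (summable_neg_mul_pow hQ x)

theorem tendsto_pochInf (hQ : ‖Q‖ < 1) (x : ℂ) :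
    Tendsto (fun N => ∏ m ∈ range N, (1 - x * Q ^ m)) atTop (𝓝 (pochInf x Q)) :=
  (multipliable_one_sub_mul_pow hQ x).hasProd.tendsto_prod_nat

theorem pochInf_ne_zero (hQ : ‖Q‖ < 1) {x : ℂ} (hx : ∀ m : ℕ, 1 - x * Q ^ m ≠ 0) :
    pochInf x Q ≠ 0 := by
  have := tprod_one_add_ne_zero_of_summable (f := fun m : ℕ => -(x * Q ^ m))
    (by simpa only [← sub_eq_add_neg] using hx) (summable_neg_mul_pow hQ x)
  simpa only [← sub_eq_add_neg] using! this

theorem one_sub_pow_ne_zero {q : ℂ} (hq : ‖q‖ < 1) {m : ℕ} (hm : m ≠ 0) : 1 - q ^ m ≠ 0 := by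
  intro h
  have h1 : ‖q ^ m‖ = 1 := by rw [← sub_eq_zero.mp h, norm_one]
  rw [norm_pow] at h1
  exact (pow_lt_one₀ (norm_nonneg _) hq hm).ne h1

theorem pochInf_self_ne_zero (hQ : ‖Q‖ < 1) : pochInf Q Q ≠ 0 :=
  pochInf_ne_zero hQ fun m => by
    rw [← pow_succ']; exact one_sub_pow_ne_zero hQ (Nat.succ_ne_zero m)

theorem pochInf_eq_mul (hQ : ‖Q‖ < 1) (x : ℂ) : pochInf x Q = (1 - x) * pochInf (x * Q) Q := by
  refine tendsto_nhds_unique ((tendsto_pochInf hQ x).comp (tendsto_add_atTop_nat 1)) ?_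
  refine ((tendsto_pochInf hQ (x * Q)).const_mul (1 - x)).congr fun N => ?_
  rw [Function.comp, Finset.prod_range_succ', pow_zero, mul_one, mul_comm]
  congr 1
  exact Finset.prod_congr rfl fun m _ => by rw [pow_succ']; ring

theorem tendsto_leftProd (hQ : ‖Q‖ < 1) (x : ℂ) :
    Tendsto (leftProd Q x) atTop (𝓝 (pochInf (x⁻¹ * Q) Q / pochInf Q Q)) := by
  refine ((tendsto_pochInf hQ _).div (tendsto_pochInf hQ _) (pochInf_self_ne_zero hQ)).congr
    fun N => ?_
  rw [Pi.div_apply, ← Finset.prod_div_distrib, leftProd]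
  exact Finset.prod_congr rfl fun m _ => by rw [pow_succ']; ring

theorem tendsto_rightProd (hQ : ‖Q‖ < 1) (x : ℂ) :
    Tendsto (rightProd Q x) atTop (𝓝 (pochInf x Q / pochInf Q Q)) := by
  refine ((tendsto_pochInf hQ _).div (tendsto_pochInf hQ _) (pochInf_self_ne_zero hQ)).congr
    fun N => ?_
  rw [Pi.div_apply, ← Finset.prod_div_distrib, rightProd]
  exact Finset.prod_congr rfl fun m _ => by rw [pow_succ']

theorem tendsto_one_sub_mul_pow (hQ : ‖Q‖ < 1) (x : ℂ) :
    Tendsto (fun N : ℕ => 1 - x * Q ^ N) atTop (𝓝 1) := by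
  simpa using ((tendsto_pow_atTop_nhds_zero_of_norm_lt_one hQ).const_mul x).const_sub 1

theorem zpow_ne_one_of_norm_lt_one (hQ0 : Q ≠ 0) (hQ : ‖Q‖ < 1) (j : ℤ) (hj : j ≠ 0) :
    Q ^ j ≠ 1 := by
  intro h
  have h1 : ‖Q‖ ^ j = 1 := by rw [← norm_zpow, h, norm_one]
  have h0 : 0 < ‖Q‖ := norm_pos_iff.mpr hQ0
  exact hj ((zpow_eq_one_iff_right₀ h0.le hQ.ne).mp h1)

theorem pochInf_inv_mul_ne_zero (hQ0 : Q ≠ 0) (hQ : ‖Q‖ < 1) {y : ℂ} (hy0 : y ≠ 0)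
    (hy : ∀ j : ℤ, 1 - y * Q ^ j ≠ 0) : pochInf (y⁻¹ * Q) Q ≠ 0 := by
  refine pochInf_ne_zero hQ fun m h => hy (-((m : ℤ) + 1)) ?_
  have e : Q ^ ((m : ℤ) + 1) = Q * Q ^ m := by
    rw [zpow_add₀ hQ0, zpow_natCast, zpow_one, mul_comm]
  rw [mul_assoc, ← e, sub_eq_zero, eq_comm, inv_mul_eq_one₀ hy0] at h
  rw [zpow_neg, ← h, mul_inv_cancel₀ hy0, sub_self]

/-- Kronecker's partial fraction expansion of `(xy)(Q/xy) / ((y)(Q/y))`. -/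
theorem kronecker_identity (hQ0 : Q ≠ 0) (hQ : ‖Q‖ < 1) {x y : ℂ} (hx0 : x ≠ 0) (hy0 : y ≠ 0)
    (hx : ∀ j : ℤ, 1 - x * Q ^ j ≠ 0) (hy : ∀ j : ℤ, 1 - y * Q ^ j ≠ 0)
    (hxy : ∀ j : ℤ, 1 - x * y * Q ^ j ≠ 0)
    (hs : Summable fun n : ℤ => x ^ n / (1 - y * Q ^ n)) :
    pochInf (x * y) Q * pochInf ((x * y)⁻¹ * Q) Q * pochInf Q Q ^ 2 =
      pochInf x Q * pochInf (x⁻¹ * Q) Q * (pochInf y Q * pochInf (y⁻¹ * Q) Q) *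
        ∑' n : ℤ, x ^ n / (1 - y * Q ^ n) := by
  have hQz := zpow_ne_one_of_norm_lt_one hQ0 hQ
  have hne := pochInf_self_ne_zero hQ
  have hfin : ∀ N : ℕ, leftProd Q (x * y) N * rightProd Q (x * y) N /
      (leftProd Q y N * (rightProd Q y N * (1 - y * Q ^ N))) =
      ∑ n ∈ Finset.Icc (-(N : ℤ)) N, leftProd Q x (N + n).toNat * rightProd Q x (N - n).toNat *
        (x ^ n / (1 - y * Q ^ n)) := by
    intro N
    -- Interpolation requires one numerator factor to be dropped; the one at j = N tends to 1 and
    -- does not affect the limit.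
    have h := finite_partial_fractions hQ0 hQz hx0 hx hy N (s := N) (by simp)
    have h1 := prod_Icc_div_prod_erase hQ0 hQz hy0 N N
    have h2 := prod_Icc_div_prod_erase hQ0 hQz (mul_ne_zero hx0 hy0) N N
    have h3 := prod_erase_ne_zero hQz (Finset.Icc (-(N : ℤ)) N) 0
    simp only [sub_zero] at h3
    have h4 : ∏ j ∈ Finset.Icc (-(N : ℤ)) N, (1 - y * Q ^ j) ≠ 0 :=
      Finset.prod_ne_zero_iff.mpr fun j _ => hy j
    rw [← Finset.mul_prod_erase _ (fun j => 1 - x * y * Q ^ j) (a := (N : ℤ)) (by simp),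
      zpow_natCast] at h2
    have h5 := hxy N
    rw [zpow_natCast] at h5
    have h6 : x ^ N ≠ 0 := pow_ne_zero _ hx0
    have h7 : y ^ N ≠ 0 := pow_ne_zero _ hy0
    rw [div_eq_iff h3] at h1
    rw [div_eq_iff h3] at h2
    replace h2 : ∏ j ∈ (Finset.Icc (-(N : ℤ)) N).erase N, (1 - x * y * Q ^ j) =
        (x * y) ^ N * leftProd Q (x * y) N * rightProd Q (x * y) N *
          ∏ j ∈ (Finset.Icc (-(N : ℤ)) N).erase 0, (1 - Q ^ j) := by
      apply mul_left_cancel₀ h5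
      rw [h2]
      ring
    have h8 : leftProd Q y N * (rightProd Q y N * (1 - y * Q ^ N)) ≠ 0 := by
      intro h0
      rw [mul_assoc (y ^ N), h0] at h1
      simp [h4] at h1
    apply mul_left_cancel₀ h6
    rw [Finset.mul_sum]
    have h9 : ∑ n ∈ Finset.Icc (-(N : ℤ)) N, x ^ N * (leftProd Q x (N + n).toNat *
        rightProd Q x (N - n).toNat * (x ^ n / (1 - y * Q ^ n))) = 
        ∑ n ∈ Finset.Icc (-(N : ℤ)) N, x ^ (N + n) * leftProd Q x (N + n).toNat *
      (rightProd Q x (N - n).toNat * (1 - x * Q ^ (N - n))) /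
        ((1 - x * Q ^ (N - n)) * (1 - y * Q ^ n)) := by
      refine Finset.sum_congr rfl fun n _ => ?_
      have := hx (N - n)
      have := hy n
      rw [zpow_add₀ hx0, zpow_natCast]
      field_simp
    rw [h9, ← h, h1, h2, mul_pow]
    field_simp
  have hy1 := pochInf_inv_mul_ne_zero hQ0 hQ hy0 hy
  have hy2 := pochInf_ne_zero hQ (x := y) fun m => by simpa using hy m
  have hl := ((tendsto_leftProd hQ (x * y)).mul (tendsto_rightProd hQ (x * y))).div
    ((tendsto_leftProd hQ y).mul ((tendsto_rightProd hQ y).mul (tendsto_one_sub_mul_pow hQ y))) ?_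
  · have hr := tendsto_sum_Icc_mul (tendsto_leftProd hQ x) (tendsto_rightProd hQ x) hs
    have := tendsto_nhds_unique (hl.congr hfin) hr
    rw [mul_one, div_mul_div_comm, div_mul_div_comm, div_mul_div_comm, div_div_div_cancel_right₀
      (mul_ne_zero hne hne), div_mul_eq_mul_div, div_eq_div_iff (mul_ne_zero hy1 hy2)
      (mul_ne_zero hne hne)] at this
    linear_combination this
  · rw [mul_one]
    exact mul_ne_zero (div_ne_zero hy1 hne) (div_ne_zero hy2 hne)

/-- The degenerate case y = 1/x: the numerator factor at j = 0 vanishes, so that is the one to drop.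
The factor left in the denominator then agrees with the pole factor up to a monomial, which produces
the square. -/
theorem kronecker_identity_double (hQ0 : Q ≠ 0) (hQ : ‖Q‖ < 1) {x : ℂ} (hx0 : x ≠ 0)
    (hx : ∀ j : ℤ, 1 - x * Q ^ j ≠ 0) (hx' : ∀ j : ℤ, 1 - x⁻¹ * Q ^ j ≠ 0)
    (hs : Summable fun n : ℤ => Q ^ n * x ^ (n - 2) / (1 - x⁻¹ * Q ^ n) ^ 2) :
    pochInf Q Q ^ 4 = (pochInf x Q * pochInf (x⁻¹ * Q) Q) ^ 2 *
        ∑' n : ℤ, Q ^ n * x ^ (n - 2) / (1 - x⁻¹ * Q ^ n) ^ 2 := by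
  have hQz := zpow_ne_one_of_norm_lt_one hQ0 hQ
  have hne := pochInf_self_ne_zero hQ
  have hfin : ∀ N : ℕ, (leftProd Q x⁻¹ N * (rightProd Q x⁻¹ N * (1 - x⁻¹ * Q ^ N)))⁻¹ =
      ∑ n ∈ Finset.Icc (-(N : ℤ)) N, leftProd Q x (N + n).toNat *
        (rightProd Q x (N - n).toNat * (1 - x * Q ^ (N - n).toNat)) *
        (-x * (Q ^ n * x ^ (n - 2) / (1 - x⁻¹ * Q ^ n) ^ 2)) := by
    intro N
    have h := finite_partial_fractions hQ0 hQz hx0 hx hx' N (s := 0) (by simp)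
    have h1 := prod_Icc_div_prod_erase hQ0 hQz (inv_ne_zero hx0) N N
    simp only [mul_inv_cancel₀ hx0, one_mul] at h
    rw [← inv_inj, inv_div] at h1
    rw [h1] at h
    have h6 : x ^ N ≠ 0 := pow_ne_zero _ hx0
    apply mul_left_cancel₀ h6
    rw [Finset.mul_sum]
    have h9 : ∀ n ∈ Finset.Icc (-(N : ℤ)) N, x ^ N * (leftProd Q x (N + n).toNat *
        (rightProd Q x (N - n).toNat * (1 - x * Q ^ (N - n).toNat)) *
        (-x * (Q ^ n * x ^ (n - 2) / (1 - x⁻¹ * Q ^ n) ^ 2))) =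
        x ^ (N + n) * leftProd Q x (N + n).toNat *
      (rightProd Q x (N - n).toNat * (1 - x * Q ^ (N - n))) /
        ((1 - x * Q ^ (0 - n)) * (1 - x⁻¹ * Q ^ n)) := by
      intro n hn
      rw [Finset.mem_Icc] at hn
      have e1 : Q ^ ((N : ℤ) - n) = Q ^ ((N : ℤ) - n).toNat := by
        rw [← zpow_natCast, Int.toNat_of_nonneg (by omega)]
      have h1 := hx (0 - n)
      have h2 := hx' n
      rw [e1, zpow_add₀ hx0, zpow_natCast, zpow_sub₀ hx0]
      rw [zpow_sub₀ hQ0, zpow_zero] at h1 ⊢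
      have h3 : Q ^ n ≠ 0 := zpow_ne_zero _ hQ0
      -- This is where the two denominators merge into a square.
      have e2 : 1 - x * (1 / Q ^ n) = -(x / Q ^ n) * (1 - x⁻¹ * Q ^ n) := by
        field_simp
        ring
      rw [e2]
      have e3 : x ^ (2 : ℤ) = x ^ 2 := by norm_cast
      rw [e3]
      generalize 1 - x⁻¹ * Q ^ n = w at *
      field_simp
    rw [Finset.sum_congr rfl h9, ← h]
    simp only [inv_pow, mul_inv, inv_inv, mul_assoc]
  have hx1 := pochInf_inv_mul_ne_zero hQ0 hQ hx0 hx
  have hx2 := pochInf_ne_zero hQ (x := x) fun m => by simpa using hx m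
  have h1x := hx 0
  rw [zpow_zero, mul_one] at h1x
  have h1x' : 1 - x⁻¹ ≠ 0 := by simpa using hx' 0
  have e1 := pochInf_eq_mul hQ x
  have hx3 : pochInf (x * Q) Q ≠ 0 := fun h => hx2 (by rw [e1, h, mul_zero])
  have e2 := pochInf_eq_mul hQ x⁻¹
  have hl := ((tendsto_leftProd hQ x⁻¹).mul
    ((tendsto_rightProd hQ x⁻¹).mul (tendsto_one_sub_mul_pow hQ x⁻¹))).inv₀ (by
      rw [mul_one, inv_inv, e2]
      exact mul_ne_zero (div_ne_zero hx3 hne) (div_ne_zero (mul_ne_zero h1x' hx1) hne))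
  have hr := tendsto_sum_Icc_mul (tendsto_leftProd hQ x)
    ((tendsto_rightProd hQ x).mul (tendsto_one_sub_mul_pow hQ x)) (hs.mul_left (-x))
  have := tendsto_nhds_unique (hl.congr hfin) hr
  rw [tsum_mul_left, inv_inv, e2, e1] at this
  rw [e1]
  generalize (∑' n : ℤ, Q ^ n * x ^ (n - 2) / (1 - x⁻¹ * Q ^ n) ^ 2) = S at *
  have e3 : 1 - x⁻¹ = -(1 - x) / x := by field_simp; ring
  rw [e3] at this
  generalize pochInf (x * Q) Q = A at *
  generalize pochInf (x⁻¹ * Q) Q = B at *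
  generalize pochInf Q Q = P at *
  generalize 1 - x = w at *
  field_simp at this
  linear_combination -this
end
end KanekoKoike

/-! ### Eta quotients as double series. -/

namespace KanekoKoike

open Finset Filter Topology

/-- The coefficient of `q^m` in `∑_{l, j ≥ 0} w(j) q^{A(l) + j B(l)}`. -/
noncomputable def doubleCoeff (w : ℕ → ℝ) (A B : ℕ → ℕ) (m : ℕ) : ℝ :=
  ∑ p ∈ (range (m + 1) ×ˢ range (m + 1)) with A p.1 + p.2 * B p.1 = m, w p.2

theorem hasSum_pow_of_fibers {ι : Type*} (h : ι → ℕ) (w : ι → ℂ) (s : ℕ → Finset ι)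
    (hs : ∀ m p, p ∈ s m ↔ h p = m) {q S : ℂ} (H : HasSum (fun p => w p * q ^ h p) S) :
    HasSum (fun m => (∑ p ∈ s m, w p) * q ^ m) S := by
  have H' := (Equiv.sigmaFiberEquiv h).hasSum_iff.mpr H
  refine H'.sigma fun m => ?_
  have e : (∑ p ∈ s m, w p) * q ^ m = ∑ p ∈ s m, w p * q ^ h p := by
    rw [Finset.sum_mul]
    exact Finset.sum_congr rfl fun p hp => by rw [(hs m p).mp hp]
  rw [e]
  have := hasSum_subtype_iff_indicator (f := fun p => w p * q ^ h p) (s := {p | h p = m})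
    (a := ∑ p ∈ s m, w p * q ^ h p)
  refine this.mpr ?_
  have h2 : ∑ p ∈ s m, w p * q ^ h p =
      ∑ p ∈ s m, Set.indicator {p | h p = m} (fun p => w p * q ^ h p) p :=
    Finset.sum_congr rfl fun p hp => by
      rw [Set.indicator_of_mem]
      exact (hs m p).mp hp
  rw [h2]
  refine hasSum_sum_of_ne_finset_zero fun p hp => ?_
  rw [Set.indicator_of_notMem]
  exact fun h => hp ((hs m p).mpr h)

/-- The bounds on `A` and `B` dominate the double series by a product of two absolutely convergent
series, so it may be summed either by total exponent or first over j. -/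
theorem hasSum_doubleCoeff {w : ℕ → ℝ} {W : ℂ → ℂ}
    (hW : ∀ z : ℂ, ‖z‖ < 1 → HasSum (fun j => (w j : ℂ) * z ^ j) (W z)) {A B : ℕ → ℕ}
    (hA : ∀ l, l ≤ A l) (hB : ∀ l, 1 ≤ B l) {q : ℂ} (hq : ‖q‖ < 1) :
    ∃ S, HasSum (fun m => (doubleCoeff w A B m : ℂ) * q ^ m) S ∧
      HasSum (fun l => q ^ A l * W (q ^ B l)) S := by
  have h1 : Summable fun p : ℕ × ℕ => ‖q ^ p.1‖ * ‖(w p.2 : ℂ) * q ^ p.2‖ := by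
    refine Summable.mul_of_nonneg ?_ (hW q hq).summable.norm (fun _ => norm_nonneg _)
      fun _ => norm_nonneg _
    simpa only [norm_pow] using summable_geometric_of_lt_one (norm_nonneg _) hq
  have h2 : Summable fun p : ℕ × ℕ => (w p.2 : ℂ) * q ^ (A p.1 + p.2 * B p.1) := by
    refine Summable.of_norm_bounded h1 fun p => ?_
    rw [pow_add, mul_left_comm, norm_mul, norm_mul (w p.2 : ℂ), norm_mul (w p.2 : ℂ)]
    simp only [norm_pow]
    have hl := pow_le_pow_of_le_one (norm_nonneg q) hq.le (hA p.1)
    have hj := pow_le_pow_of_le_one (norm_nonneg q) hq.le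
      (show p.2 ≤ p.2 * B p.1 from Nat.le_mul_of_pos_right _ (hB p.1))
    gcongr
  obtain ⟨S, hS⟩ := h2
  refine ⟨S, ?_, ?_⟩
  · have := hasSum_pow_of_fibers (fun p : ℕ × ℕ => A p.1 + p.2 * B p.1) (fun p => (w p.2 : ℂ))
      (fun m => (range (m + 1) ×ˢ range (m + 1)).filter fun p => A p.1 + p.2 * B p.1 = m) ?_ hS
    · simpa only [doubleCoeff, Complex.ofReal_sum] using this
    · intro m p
      simp only [Finset.mem_filter, Finset.mem_product, Finset.mem_range, and_iff_right_iff_imp]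
      intro h
      have := hA p.1
      have := Nat.le_mul_of_pos_right p.2 (hB p.1)
      omega
  · refine hS.prod_fiberwise fun l => ?_
    have hz : ‖q ^ B l‖ < 1 := by
      rw [norm_pow]; exact pow_lt_one₀ (norm_nonneg _) hq (by have := hB l; omega)
    refine ((hW _ hz).mul_left (q ^ A l)).congr_fun fun j => ?_
    rw [pow_add, mul_comm j, pow_mul]; ring

theorem hasSum_geometric_sq {z : ℂ} (hz : ‖z‖ < 1) :
    HasSum (fun j : ℕ => (((j : ℝ) + 1 : ℝ) : ℂ) * z ^ j) (1 / (1 - z) ^ 2) := by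
  have := hasSum_choose_mul_geometric_of_norm_lt_one 1 hz
  simpa using this

theorem hasSum_geometric_odd {z : ℂ} (hz : ‖z‖ < 1) :
    HasSum (fun j : ℕ => ((2 * (j : ℝ) + 1 : ℝ) : ℂ) * z ^ j) ((1 + z) / (1 - z) ^ 2) := by
  have h1 := hasSum_geometric_sq hz
  have h2 := hasSum_coe_mul_geometric_of_norm_lt_one hz
  have := h1.add h2
  rw [← add_div] at this
  refine this.congr_fun fun j => ?_
  push_cast; ring

theorem hasSum_geometric_one {z : ℂ} (hz : ‖z‖ < 1) :
    HasSum (fun j : ℕ => (((fun _ => 1 : ℕ → ℝ) j : ℝ) : ℂ) * z ^ j) (1 / (1 - z)) := by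
  simpa using hasSum_geometric_of_norm_lt_one hz

section
variable {q : ℂ}

theorem one_sub_zpow_ne_zero (hq0 : q ≠ 0) (hq : ‖q‖ < 1) {j : ℤ} (hj : j ≠ 0) : 1 - q ^ j ≠ 0 :=
  sub_ne_zero.mpr (zpow_ne_one_of_norm_lt_one hq0 hq j hj).symm

theorem norm_pow_lt_one (hq : ‖q‖ < 1) {b : ℕ} (hb : b ≠ 0) : ‖q ^ b‖ < 1 := by
  rw [norm_pow]; exact pow_lt_one₀ (norm_nonneg _) hq hb

theorem one_sub_mul_zpow_ne_zero (hq0 : q ≠ 0) (hq : ‖q‖ < 1) {b : ℕ} {a : ℤ}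
    (hab : ¬ (b : ℤ) ∣ a) (j : ℤ) : 1 - q ^ a * (q ^ b) ^ j ≠ 0 := by
  rw [← zpow_natCast q b, ← zpow_mul, ← zpow_add₀ hq0]
  refine one_sub_zpow_ne_zero hq0 hq fun h => hab ⟨-j, ?_⟩
  linarith

theorem hasSum_int_of_neg {f : ℤ → ℂ} {a b : ℂ} (h1 : HasSum (fun n : ℕ => f (-(n : ℤ))) a)
    (h2 : HasSum (fun n : ℕ => f ((n : ℤ) + 1)) b) : HasSum f (a + b) := by
  have := HasSum.of_nat_of_neg_add_one (f := fun n => f (-n)) h1 (by simpa using h2)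
  exact (Equiv.neg ℤ).hasSum_iff.mp this

/-- The factors 1 - q^m are sorted by the residue of m modulo 2. -/
theorem pochInf_eq_prod_two (hq : ‖q‖ < 1) :
    pochInf q (q ^ 2) * pochInf (q ^ 2) (q ^ 2) = pochInf q q := by
  have h2 := norm_pow_lt_one hq (b := 2) (by norm_num)
  refine tendsto_nhds_unique ((tendsto_pochInf h2 _).mul (tendsto_pochInf h2 _)) ?_
  have : Tendsto (fun N : ℕ => 2 * N) atTop atTop :=
    tendsto_id.const_mul_atTop' (by norm_num)
  refine ((tendsto_pochInf hq q).comp this).congr fun N => ?_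
  simp only [Function.comp]
  induction N with
  | zero => simp
  | succ N ih =>
    rw [show 2 * (N + 1) = 2 * N + 1 + 1 by ring, Finset.prod_range_succ, Finset.prod_range_succ, ih,
      Finset.prod_range_succ, Finset.prod_range_succ]
    ring

theorem pochInf_eq_prod_three (hq : ‖q‖ < 1) :
    pochInf q (q ^ 3) * pochInf (q ^ 2) (q ^ 3) * pochInf (q ^ 3) (q ^ 3) = pochInf q q := by
  have h2 := norm_pow_lt_one hq (b := 3) (by norm_num)
  refine tendsto_nhds_unique (((tendsto_pochInf h2 _).mul (tendsto_pochInf h2 _)).mul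
    (tendsto_pochInf h2 _)) ?_
  have : Tendsto (fun N : ℕ => 3 * N) atTop atTop :=
    tendsto_id.const_mul_atTop' (by norm_num)
  refine ((tendsto_pochInf hq q).comp this).congr fun N => ?_
  simp only [Function.comp]
  induction N with
  | zero => simp
  | succ N ih =>
    rw [show 3 * (N + 1) = 3 * N + 1 + 1 + 1 by ring, Finset.prod_range_succ,
      Finset.prod_range_succ, Finset.prod_range_succ, ih,
      Finset.prod_range_succ, Finset.prod_range_succ, Finset.prod_range_succ]
    ring

/-- The bilateral series of `kronecker_identity_double` at `x = q`, `Q = q^b`, cut at `0`. -/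
theorem hasSum_double_series (hq0 : q ≠ 0) (hq : ‖q‖ < 1) {b : ℕ} (hb : 2 ≤ b) {S₁ S₂ : ℂ}
    (h1 : HasSum (fun l : ℕ => q ^ ((b - 1) * l) * (1 / (1 - q ^ (b * l + 1)) ^ 2)) S₁)
    (h2 : HasSum (fun l : ℕ => q ^ ((b + 1) * l + (b - 1)) *
      (1 / (1 - q ^ (b * l + (b - 1))) ^ 2)) S₂) :
    pochInf (q ^ b) (q ^ b) ^ 4 =
      (pochInf q (q ^ b) * pochInf (q ^ (b - 1)) (q ^ b)) ^ 2 * (S₁ + S₂) := by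
  obtain ⟨c, rfl⟩ : ∃ c, b = c + 1 := ⟨b - 1, by omega⟩
  simp only [Nat.add_sub_cancel] at h1 h2 ⊢
  have hQ0 : q ^ (c + 1) ≠ 0 := pow_ne_zero _ hq0
  have hz : ∀ n : ℤ, (q ^ (c + 1)) ^ n = q ^ (((c : ℤ) + 1) * n) := fun n => by
    rw [zpow_mul]; norm_cast
  have hs : HasSum (fun n : ℤ => (q ^ (c + 1)) ^ n * q ^ (n - 2) /
      (1 - q⁻¹ * (q ^ (c + 1)) ^ n) ^ 2) (S₁ + S₂) := by
    refine hasSum_int_of_neg (h1.congr_fun fun l => ?_) (h2.congr_fun fun l => ?_)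
    · have e1 : q ^ (c * l) = q ^ ((c : ℤ) * l) := by norm_cast
      have e2 : q ^ ((c + 1) * l + 1) = q ^ (((c : ℤ) + 1) * l + 1) := by norm_cast
      have e3 : q⁻¹ * q ^ (((c : ℤ) + 1) * -l) = q ^ (-(((c : ℤ) + 1) * l + 1)) := by
        rw [← zpow_neg_one, ← zpow_add₀ hq0]; congr 1; ring
      have hne : 1 - q ^ (((c : ℤ) + 1) * l + 1) ≠ 0 :=
        one_sub_zpow_ne_zero hq0 hq (by positivity)
      rw [hz, e1, e2, e3, ← zpow_add₀ hq0, zpow_neg]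
      have e4 : q ^ (((c : ℤ) + 1) * -l + (-l - 2)) =
          q ^ ((c : ℤ) * l) / (q ^ (((c : ℤ) + 1) * l + 1)) ^ 2 := by
        rw [← zpow_natCast, ← zpow_mul, ← zpow_sub₀ hq0]; congr 1; push_cast; ring
      have hne' : q ^ (((c : ℤ) + 1) * l + 1) ≠ 0 := zpow_ne_zero _ hq0
      rw [e4]
      generalize q ^ (((c : ℤ) + 1) * l + 1) = z at *
      have : 1 - z⁻¹ = -(1 - z) / z := by field_simp; ring
      rw [this]
      field_simp
    · have e1 : q ^ ((c + 1 + 1) * l + c) = q ^ (((c : ℤ) + 1 + 1) * l + c) := by norm_cast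
      have e2 : q ^ ((c + 1) * l + c) = q ^ (((c : ℤ) + 1) * l + c) := by norm_cast
      have e3 : q⁻¹ * q ^ (((c : ℤ) + 1) * (l + 1)) = q ^ (((c : ℤ) + 1) * l + c) := by
        rw [← zpow_neg_one, ← zpow_add₀ hq0]; congr 1; ring
      rw [hz, e1, e2, e3, ← zpow_add₀ hq0, mul_one_div]
      congr 2; ring
  have hd : ¬ ((c + 1 : ℕ) : ℤ) ∣ 1 := fun h => by
    have := Int.le_of_dvd one_pos h; push_cast at this; omega
  have hd' : ¬ ((c + 1 : ℕ) : ℤ) ∣ -1 := fun h => hd (by simpa using h)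
  have := kronecker_identity_double hQ0 (norm_pow_lt_one hq (by omega)) hq0
    (by simpa using one_sub_mul_zpow_ne_zero hq0 hq hd)
    (by simpa using one_sub_mul_zpow_ne_zero hq0 hq hd') hs.summable
  rw [hs.tsum_eq] at this
  rw [this, show q⁻¹ * q ^ (c + 1) = q ^ c by rw [pow_succ', inv_mul_cancel_left₀ hq0]]

theorem hasSum_eulerProd_two (hq0 : q ≠ 0) (hq : ‖q‖ < 1) :
    HasSum (fun m => (doubleCoeff (fun j => 2 * (j : ℝ) + 1) (fun l => l) (fun l => 2 * l + 1) m : ℂ)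
      * q ^ m) (pochInf (q ^ 2) (q ^ 2) ^ 8 / pochInf q q ^ 4) := by
  obtain ⟨S, hS, hS'⟩ := hasSum_doubleCoeff (fun z hz => hasSum_geometric_odd hz)
    (A := fun l => l) (B := fun l => 2 * l + 1) (fun l => le_rfl) (fun l => by omega) hq
  obtain ⟨S₁, -, hS₁⟩ := hasSum_doubleCoeff (fun z hz => hasSum_geometric_sq hz)
    (A := fun l => (2 - 1) * l) (B := fun l => 2 * l + 1) (fun l => by omega) (fun l => by omega) hq
  obtain ⟨S₂, -, hS₂⟩ := hasSum_doubleCoeff (fun z hz => hasSum_geometric_sq hz)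
    (A := fun l => (2 + 1) * l + (2 - 1)) (B := fun l => 2 * l + (2 - 1))
    (fun l => by omega) (fun l => by omega) hq
  -- With z = q^(2l+1), the two halves of the bilateral series share a denominator and their
  -- numerators add up to q^l (1 + z).
  have e : S₁ + S₂ = S := by
    refine HasSum.unique ((hS₁.add hS₂).congr_fun fun l => ?_) hS'
    simp only [one_mul, Nat.reduceSub, Nat.reduceAdd]
    ring
  have h := hasSum_double_series hq0 hq le_rfl hS₁ hS₂
  simp only [Nat.reduceSub, pow_one] at h
  rw [e, ← pow_two, ← pow_mul] at h
  convert hS using 1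
  have h2 := pochInf_eq_prod_two hq
  have hne := pochInf_self_ne_zero (norm_pow_lt_one hq (b := 2) (by norm_num))
  have hne' := pochInf_self_ne_zero hq
  rw [← h2] at hne' ⊢
  rw [div_eq_iff (pow_ne_zero _ hne')]
  linear_combination pochInf (q ^ 2) (q ^ 2) ^ 4 * h

theorem hasSum_eulerProd_three_sq (hq0 : q ≠ 0) (hq : ‖q‖ < 1) :
    HasSum (fun m => ((doubleCoeff (fun j => (j : ℝ) + 1) (fun l => (3 - 1) * l)
      (fun l => 3 * l + 1) m + doubleCoeff (fun j => (j : ℝ) + 1) (fun l => (3 + 1) * l + (3 - 1))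
        (fun l => 3 * l + (3 - 1)) m : ℝ) : ℂ)
      * q ^ m) ((pochInf (q ^ 3) (q ^ 3) ^ 3 / pochInf q q) ^ 2) := by
  obtain ⟨S₁, hS, hS₁⟩ := hasSum_doubleCoeff (fun z hz => hasSum_geometric_sq hz)
    (A := fun l => (3 - 1) * l) (B := fun l => 3 * l + 1) (fun l => by omega) (fun l => by omega) hq
  obtain ⟨S₂, hS', hS₂⟩ := hasSum_doubleCoeff (fun z hz => hasSum_geometric_sq hz)
    (A := fun l => (3 + 1) * l + (3 - 1)) (B := fun l => 3 * l + (3 - 1))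
    (fun l => by omega) (fun l => by omega) hq
  have h := hasSum_double_series hq0 hq (by norm_num) hS₁ hS₂
  simp only [Nat.reduceSub] at h
  have h3 := pochInf_eq_prod_three hq
  have hne' := pochInf_self_ne_zero hq
  have e : (pochInf (q ^ 3) (q ^ 3) ^ 3 / pochInf q q) ^ 2 = S₁ + S₂ := by
    rw [← h3] at hne' ⊢
    rw [div_pow, div_eq_iff (pow_ne_zero _ hne')]
    linear_combination pochInf (q ^ 3) (q ^ 3) ^ 2 * h
  rw [e]
  refine (hS.add hS').congr_fun fun m => ?_
  push_cast; ring

theorem hasSum_eulerProd_three (hq0 : q ≠ 0) (hq : ‖q‖ < 1) :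
    HasSum (fun m => ((doubleCoeff (fun _ => 1) (fun l => l) (fun l => 3 * l + 1) m -
      doubleCoeff (fun _ => 1) (fun l => 2 * l + 1) (fun l => 3 * l + 2) m : ℝ) : ℂ)
      * q ^ m) (pochInf (q ^ 3) (q ^ 3) ^ 3 / pochInf q q) := by
  obtain ⟨S₁, hS, hS₁⟩ := hasSum_doubleCoeff (fun z hz => hasSum_geometric_one hz)
    (A := fun l => l) (B := fun l => 3 * l + 1) (fun l => by omega) (fun l => by omega) hq
  obtain ⟨S₂, hS', hS₂⟩ := hasSum_doubleCoeff (fun z hz => hasSum_geometric_one hz)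
    (A := fun l => 2 * l + 1) (B := fun l => 3 * l + 2) (fun l => by omega) (fun l => by omega) hq
  have hz : ∀ n : ℤ, (q ^ 3) ^ n = q ^ (3 * n) := fun n => by rw [zpow_mul]; norm_cast
  have hs : HasSum (fun n : ℤ => q ^ n / (1 - q * (q ^ 3) ^ n)) (S₁ + -S₂) := by
    -- Rewriting 1 - 1/z as -(1 - z)/z at negative indices gives the minus sign of the second
    -- series.
    refine HasSum.of_nat_of_neg_add_one (hS₁.congr_fun fun l => ?_) (hS₂.neg.congr_fun fun l => ?_)
    · rw [zpow_natCast, zpow_natCast, ← pow_mul, ← pow_succ', mul_one_div]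
    · have e2 : q * q ^ (3 * -((l : ℤ) + 1)) = (q ^ (3 * l + 2))⁻¹ := by
        rw [← zpow_natCast, ← zpow_neg, ← zpow_one_add₀ hq0]; congr 1
      have e3 : q ^ (-((l : ℤ) + 1)) = q ^ (2 * l + 1) / q ^ (3 * l + 2) := by
        rw [← zpow_natCast, ← zpow_natCast, ← zpow_sub₀ hq0]; congr 1; push_cast; ring
      rw [hz, e2, e3]
      have h1 := one_sub_pow_ne_zero hq (m := 3 * l + 2) (by omega)
      have h2 : q ^ (3 * l + 2) ≠ 0 := pow_ne_zero _ hq0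
      generalize q ^ (3 * l + 2) = z at *
      have : 1 - z⁻¹ = -(1 - z) / z := by field_simp; ring
      rw [this]
      field_simp
  have h1 : ∀ j : ℤ, 1 - q * (q ^ 3) ^ j ≠ 0 := by
    simpa using one_sub_mul_zpow_ne_zero hq0 hq (b := 3) (a := 1) (by norm_num)
  have h2 : ∀ j : ℤ, 1 - q * q * (q ^ 3) ^ j ≠ 0 := by
    have := one_sub_mul_zpow_ne_zero hq0 hq (b := 3) (a := 2) (by norm_num)
    intro j
    have h := this j
    rwa [show q ^ (2 : ℤ) = q * q by rw [← pow_two]; norm_cast] at h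
  have hQ := norm_pow_lt_one hq (b := 3) (by norm_num)
  -- With x = y = q and Q = q³, the theta product at xy = q² equals the one at q, so one theta
  -- product cancels.
  have h := kronecker_identity (pow_ne_zero 3 hq0) hQ hq0 hq0 h1 h1 h2 hs.summable
  rw [hs.tsum_eq] at h
  have e1 : (q * q)⁻¹ * q ^ 3 = q := by field_simp
  have e2 : q⁻¹ * q ^ 3 = q ^ 2 := by field_simp
  rw [e1, e2, ← pow_two] at h
  have h3 := pochInf_eq_prod_three hq
  have hne' := pochInf_self_ne_zero hq
  have e : pochInf (q ^ 3) (q ^ 3) ^ 3 / pochInf q q = S₁ + -S₂ := by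
    rw [← h3] at hne' ⊢
    rw [div_eq_iff hne']
    have h4 : pochInf q (q ^ 3) * pochInf (q ^ 2) (q ^ 3) ≠ 0 := left_ne_zero_of_mul hne'
    apply mul_left_cancel₀ h4
    linear_combination pochInf (q ^ 3) (q ^ 3) * h
  rw [e]
  refine (hS.add hS'.neg).congr_fun fun m => ?_
  push_cast; ring

end

end KanekoKoike

namespace KanekoKoike

open Finset Filter Topology

/-! ### Coefficients as divisor sums -/

/-- The sum is the convolution of 1 with a quadratic character, whose nonnegativity is
`DirichletCharacter.zetaMul_nonneg`. -/
theorem sum_divisors_legendreSym_nonneg (n : ℕ) :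
    0 ≤ ∑ d ∈ n.divisors, legendreSym 3 (d : ℤ) := by
  set χ : DirichletCharacter ℂ 3 := (quadraticChar (ZMod 3)).ringHomComp (Int.castRingHom ℂ)
  have hχ : χ ^ 2 = 1 :=
    MulChar.isQuadratic_iff_sq_eq_one.mp ((quadraticChar_isQuadratic (ZMod 3)).comp _)
  have h := DirichletCharacter.zetaMul_nonneg hχ n
  have e : DirichletCharacter.zetaMul χ n =
      ((∑ d ∈ n.divisors, legendreSym 3 (d : ℤ) : ℤ) : ℂ) := by
    rw [DirichletCharacter.zetaMul, ArithmeticFunction.coe_zeta_mul_apply, Int.cast_sum]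
    refine Finset.sum_congr rfl fun d hd => ?_
    have hd0 : d ≠ 0 := (Nat.pos_of_mem_divisors hd).ne'
    simp [toArithmeticFunction, hd0, χ, legendreSym]
  rw [e, ← Complex.ofReal_intCast, Complex.zero_le_real] at h
  exact_mod_cast h

theorem legendreSym_three (d : ℕ) :
    legendreSym 3 (d : ℤ) = (if d % 3 = 1 then 1 else 0) - (if d % 3 = 2 then 1 else 0) := by
  rw [legendreSym.mod]
  have h : d % 3 = 0 ∨ d % 3 = 1 ∨ d % 3 = 2 := by omega
  have e : ((d : ℤ) % (3 : ℕ)) = ((d % 3 : ℕ) : ℤ) := by push_cast; rfl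
  rw [e]
  rcases h with h | h | h <;> rw [h] <;> decide

theorem doubleCoeff_nonneg {w : ℕ → ℝ} (hw : ∀ j, 0 ≤ w j) (A B : ℕ → ℕ) (m : ℕ) :
    0 ≤ doubleCoeff w A B m :=
  Finset.sum_nonneg fun _ _ => hw _

/-- The condition l + j(2l+1) = m says (2l+1)(2j+1) = 2m+1, and the weight is the divisor 2j+1
itself. -/
theorem doubleCoeff_two (m : ℕ) :
    doubleCoeff (fun j => 2 * (j : ℝ) + 1) (fun l => l) (fun l => 2 * l + 1) m =
      ArithmeticFunction.sigma 1 (2 * m + 1) := by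
  rw [doubleCoeff, ArithmeticFunction.sigma_one_apply, Nat.cast_sum]
  refine Finset.sum_bij' (fun p _ => 2 * p.2 + 1) (fun d _ => (((2 * m + 1) / d - 1) / 2, (d - 1) / 2))
    ?_ ?_ ?_ ?_ ?_
  · rintro ⟨l, j⟩ h
    simp only [Finset.mem_filter] at h
    rw [Nat.mem_divisors]
    exact ⟨⟨2 * l + 1, by rw [← h.2]; ring⟩, by omega⟩
  · intro d hd
    obtain ⟨⟨e, he⟩, -⟩ := Nat.mem_divisors.mp hd
    have hd0 := Nat.pos_of_mem_divisors hd
    have hodd : Odd (d * e) := ⟨m, he.symm⟩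
    obtain ⟨⟨a, rfl⟩, ⟨b, rfl⟩⟩ := Nat.odd_mul.mp hodd
    have e1 : (2 * m + 1) / (2 * a + 1) = 2 * b + 1 := by
      rw [he]; exact Nat.mul_div_cancel_left _ hd0
    simp only [e1, Nat.add_sub_cancel, Nat.mul_div_cancel_left _ two_pos, Finset.mem_filter,
      Finset.mem_product, Finset.mem_range]
    have h2 : b + a * (2 * b + 1) = m := by nlinarith
    refine ⟨⟨?_, ?_⟩, h2⟩
    · exact Nat.lt_succ_of_le (le_trans (Nat.le_add_right _ _) h2.le)
    · nlinarith
  · rintro ⟨l, j⟩ h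
    simp only [Finset.mem_filter] at h
    have e1 : (2 * m + 1) / (2 * j + 1) = 2 * l + 1 := by
      rw [show 2 * m + 1 = (2 * j + 1) * (2 * l + 1) by rw [← h.2]; ring]
      exact Nat.mul_div_cancel_left _ (by omega)
    simp [e1]
  · intro d hd
    obtain ⟨⟨e, he⟩, -⟩ := Nat.mem_divisors.mp hd
    have hodd : Odd (d * e) := ⟨m, he.symm⟩
    obtain ⟨⟨a, rfl⟩, -⟩ := Nat.odd_mul.mp hodd
    simp
  · rintro ⟨l, j⟩ _
    push_cast; ring

/-- Index pairs are factorizations of 3m+1 with both factors congruent to a modulo 3; since the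
product is 1 modulo 3, one factor in that class forces the other into it. -/
theorem doubleCoeff_eq_card (A B : ℕ → ℕ) (a m : ℕ) (ha : a = 1 ∨ a = 2) (hA : ∀ l, l ≤ A l)
    (hB : ∀ l, 1 ≤ B l)
    (h : ∀ l j, 3 * (A l + j * B l) + 1 = (3 * l + a) * (3 * j + a)) :
    doubleCoeff (fun _ => 1) A B m = ∑ d ∈ (3 * m + 1).divisors, if d % 3 = a then 1 else 0 := by
  rw [doubleCoeff, ← Finset.sum_filter]
  have key : ∀ d e : ℕ, d * e = 3 * m + 1 → d % 3 = a → e % 3 = a := by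
    intro d e he hd
    have h1 : (d * e) % 3 = 1 := by omega
    rw [Nat.mul_mod, hd] at h1
    have h2 : e % 3 = 0 ∨ e % 3 = 1 ∨ e % 3 = 2 := by omega
    rcases ha with rfl | rfl <;> rcases h2 with h2 | h2 | h2 <;> rw [h2] at h1 ⊢ <;> omega
  refine Finset.sum_bij' (fun p _ => 3 * p.2 + a)
    (fun d _ => (((3 * m + 1) / d) / 3, d / 3)) ?_ ?_ ?_ ?_ ?_
  · rintro ⟨l, j⟩ hp
    simp only [Finset.mem_filter] at hp ⊢
    rw [Nat.mem_divisors]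
    exact ⟨⟨⟨3 * l + a, by rw [← hp.2, h]; ring⟩, by omega⟩, by omega⟩
  · intro d hd
    rw [Finset.mem_filter] at hd
    obtain ⟨⟨e, he⟩, -⟩ := Nat.mem_divisors.mp hd.1
    have hd0 := Nat.pos_of_mem_divisors hd.1
    have e1 : (3 * m + 1) / d = e := by rw [he]; exact Nat.mul_div_cancel_left _ hd0
    have he3 := key d e he.symm hd.2
    have h3 := h (e / 3) (d / 3)
    rw [show 3 * (e / 3) + a = e by omega, show 3 * (d / 3) + a = d by omega, mul_comm e, ← he] at h3
    simp only [e1, Finset.mem_filter, Finset.mem_product, Finset.mem_range]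
    have := hA (e / 3)
    have := Nat.le_mul_of_pos_right (d / 3) (hB (e / 3))
    omega
  · rintro ⟨l, j⟩ hp
    simp only [Finset.mem_filter] at hp
    have e1 : (3 * m + 1) / (3 * j + a) = 3 * l + a := by
      rw [← hp.2, h, mul_comm]
      exact Nat.mul_div_cancel_left _ (by omega)
    simp only [e1, Prod.mk.injEq]
    omega
  · intro d hd
    rw [Finset.mem_filter] at hd
    omega
  · intro p _; rfl

theorem doubleCoeff_three (m : ℕ) :
    doubleCoeff (fun _ => 1) (fun l => l) (fun l => 3 * l + 1) m -
      doubleCoeff (fun _ => 1) (fun l => 2 * l + 1) (fun l => 3 * l + 2) m =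
    ((∑ d ∈ (3 * m + 1).divisors, legendreSym 3 (d : ℤ) : ℤ) : ℝ) := by
  rw [doubleCoeff_eq_card _ _ 1 m (.inl rfl) (fun l => le_rfl) (fun l => by omega)
    (fun l j => by ring), doubleCoeff_eq_card _ _ 2 m (.inr rfl) (fun l => by omega)
    (fun l => by omega) (fun l j => by ring), ← Finset.sum_sub_distrib, Int.cast_sum]
  refine Finset.sum_congr rfl fun d _ => ?_
  rw [legendreSym_three]
  push_cast; rfl

/-! ### Gauss's triangular number identity -/

/-- `∏_{r < n} (1 - q^{2r+2}) / (1 - q^{2r+1})`. -/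
noncomputable def gaussProd (q : ℂ) (n : ℕ) : ℂ :=
  ∏ r ∈ range n, ((1 - q ^ (2 * r + 2)) / (1 - q ^ (2 * r + 1)))

section
variable {q : ℂ}

theorem gaussProd_ne_zero (hq : ‖q‖ < 1) (n : ℕ) : gaussProd q n ≠ 0 :=
  Finset.prod_ne_zero_iff.mpr fun _ _ =>
    div_ne_zero (one_sub_pow_ne_zero hq (by omega)) (one_sub_pow_ne_zero hq (by omega))

theorem gaussProd_succ (q : ℂ) (n : ℕ) :
    gaussProd q (n + 1) = gaussProd q n * ((1 - q ^ (2 * n + 2)) / (1 - q ^ (2 * n + 1))) :=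
  Finset.prod_range_succ _ _

/-- The change of each summand of Shanks's sum under n ↦ n+1 is a difference in s, so it telescopes;
the right side is the boundary term. -/
theorem sum_gaussProd_div_telescope (hq : ‖q‖ < 1) (n N : ℕ) :
    ∑ s ∈ range N, (gaussProd q (n + 1) / gaussProd q s * q ^ (s * (2 * n + 3)) -
      gaussProd q n / gaussProd q s * q ^ (s * (2 * n + 1))) =
    gaussProd q n / gaussProd q N * (1 - q ^ (2 * N)) * q ^ (N * (2 * n + 1)) /
      (1 - q ^ (2 * n + 1)) := by
  induction N with
  | zero => simp
  | succ N ih =>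
    rw [Finset.sum_range_succ, ih, gaussProd_succ, gaussProd_succ]
    have h1 := gaussProd_ne_zero hq N
    have h2 := one_sub_pow_ne_zero hq (m := 2 * n + 1) (by omega)
    have h3 := one_sub_pow_ne_zero hq (m := 2 * N + 1) (by omega)
    have h4 := one_sub_pow_ne_zero hq (m := 2 * N + 2) (by omega)
    rw [show 2 * (N + 1) = 2 * N + 2 by ring]
    field_simp
    ring

/-- Shanks's finite form of Gauss's identity. -/
theorem sum_triangular_eq (hq : ‖q‖ < 1) (n : ℕ) :
    ∑ s ∈ range (2 * n), q ^ (s * (s + 1) / 2) =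
      ∑ s ∈ range n, gaussProd q n / gaussProd q s * q ^ (s * (2 * n + 1)) := by
  induction n with
  | zero => simp
  | succ n ih =>
    -- At N = n the boundary term combines with the new summand s = n into the triangular powers
    -- with indices 2n and 2n+1.
    have h := sum_gaussProd_div_telescope hq n n
    rw [Finset.sum_sub_distrib, ← ih, sub_eq_iff_eq_add] at h
    rw [show 2 * (n + 1) = 2 * n + 1 + 1 by ring, Finset.sum_range_succ, Finset.sum_range_succ,
      Finset.sum_range_succ _ n, show 2 * n + 1 + 1 + 1 = 2 * n + 3 by ring, h, gaussProd_succ]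
    have h1 := gaussProd_ne_zero hq n
    have h2 := one_sub_pow_ne_zero hq (m := 2 * n + 1) (by omega)
    have e1 : 2 * n * (2 * n + 1) / 2 = n * (2 * n + 1) := by
      rw [mul_assoc, Nat.mul_div_cancel_left _ two_pos]
    have e2 : (2 * n + 1) * (2 * n + 1 + 1) / 2 = n * (2 * n + 1) + (2 * n + 1) := by
      rw [show (2 * n + 1) * (2 * n + 1 + 1) = 2 * (n * (2 * n + 1) + (2 * n + 1)) by ring,
        Nat.mul_div_cancel_left _ two_pos]
    rw [e1, e2]
    field_simp
    ring

theorem tendsto_gaussProd (hq : ‖q‖ < 1) :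
    Tendsto (gaussProd q) atTop (𝓝 (pochInf (q ^ 2) (q ^ 2) ^ 2 / pochInf q q)) := by
  have h2 := norm_pow_lt_one hq (b := 2) (by norm_num)
  have hne := pochInf_self_ne_zero hq
  have h := pochInf_eq_prod_two hq
  rw [← h] at hne ⊢
  rw [pow_two (pochInf _ _), mul_div_mul_right _ _ (right_ne_zero_of_mul hne)]
  refine ((tendsto_pochInf h2 _).div (tendsto_pochInf h2 _) (left_ne_zero_of_mul hne)).congr
    fun N => ?_
  rw [Pi.div_apply, ← Finset.prod_div_distrib, gaussProd]
  exact Finset.prod_congr rfl fun m _ => by ring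

theorem summable_triangular (hq : ‖q‖ < 1) : Summable fun s : ℕ => q ^ (s * (s + 1) / 2) := by
  refine Summable.of_norm_bounded (summable_geometric_of_lt_one (norm_nonneg q) hq) fun s => ?_
  rw [norm_pow]
  refine pow_le_pow_of_le_one (norm_nonneg q) hq.le ?_
  rw [Nat.le_div_iff_mul_le two_pos]
  rcases s with _ | s
  · simp
  · exact Nat.mul_le_mul_left _ (by omega)

theorem hasSum_triangular (hq : ‖q‖ < 1) :
    HasSum (fun s : ℕ => q ^ (s * (s + 1) / 2)) (pochInf (q ^ 2) (q ^ 2) ^ 2 / pochInf q q) := by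
  have hT := tendsto_gaussProd hq
  have hne : pochInf (q ^ 2) (q ^ 2) ^ 2 / pochInf q q ≠ 0 :=
    div_ne_zero (pow_ne_zero _ (pochInf_self_ne_zero (norm_pow_lt_one hq (by norm_num))))
      (pochInf_self_ne_zero hq)
  have hs := (summable_triangular hq).hasSum
  obtain ⟨C, hC⟩ := hT.norm.bddAbove_range
  obtain ⟨D, hD⟩ := (hT.inv₀ hne).norm.bddAbove_range
  have hC' : ∀ n, ‖gaussProd q n‖ ≤ C := fun n => hC ⟨n, rfl⟩
  have hD' : ∀ n, ‖(gaussProd q n)⁻¹‖ ≤ D := fun n => hD ⟨n, rfl⟩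
  have hC0 : 0 ≤ C := (norm_nonneg _).trans (hC' 0)
  have hD0 : 0 ≤ D := (norm_nonneg _).trans (hD' 0)
  -- In the limit only s = 0 survives, since the exponent s(2n+1) tends to infinity for every s > 0.
  have key := tendsto_tsum_of_dominated_convergence (𝓕 := atTop)
    (f := fun (n s : ℕ) => if s ∈ range n then
      gaussProd q n / gaussProd q s * q ^ (s * (2 * n + 1)) else 0)
    (g := fun s => if s = 0 then pochInf (q ^ 2) (q ^ 2) ^ 2 / pochInf q q else 0)
    (bound := fun s => C * D * ‖q‖ ^ s)
    ((summable_geometric_of_lt_one (norm_nonneg q) hq).mul_left _) ?_ ?_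
  · rw [tsum_ite_eq] at key
    have h2 : Tendsto (fun N : ℕ => 2 * N) atTop atTop :=
      tendsto_id.const_mul_atTop' (by norm_num)
    have h3 := tendsto_nhds_unique (key.congr fun n => ?_) (hs.tendsto_sum_nat.comp h2)
    · rwa [← h3] at hs
    · rw [tsum_eq_sum (s := range n) (fun s hs => if_neg hs), Function.comp,
        sum_triangular_eq hq]
      exact Finset.sum_congr rfl fun s hs => if_pos hs
  · intro s
    rcases Nat.eq_zero_or_pos s with rfl | hs
    · rw [if_pos rfl]
      refine hT.congr' ?_
      filter_upwards [eventually_ge_atTop 1] with n hn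
      rw [if_pos (Finset.mem_range.mpr hn)]
      simp [gaussProd]
    · rw [if_neg hs.ne']
      have h4 : Tendsto (fun n : ℕ => s * (2 * n + 1)) atTop atTop := by
        refine tendsto_atTop_mono (fun n => ?_) tendsto_id
        simp only [id]
        nlinarith
      have h5 := ((hT.div_const (gaussProd q s)).mul
        ((tendsto_pow_atTop_nhds_zero_of_norm_lt_one hq).comp h4))
      rw [mul_zero] at h5
      refine h5.congr' ?_
      filter_upwards [eventually_gt_atTop s] with n hn
      rw [if_pos (Finset.mem_range.mpr hn)]
      rfl
  · refine Eventually.of_forall fun n s => ?_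
    split_ifs
    · rw [norm_mul, div_eq_mul_inv, norm_mul, norm_pow]
      have := hC' n
      have := hD' s
      have h6 : ‖q‖ ^ (s * (2 * n + 1)) ≤ ‖q‖ ^ s :=
        pow_le_pow_of_le_one (norm_nonneg q) hq.le (Nat.le_mul_of_pos_right _ (by omega))
      gcongr
    · rw [norm_zero]; positivity

/-- The number of `s` with `s(s+1)/2 = m`. -/
def triangularCount (m : ℕ) : ℕ := #{s ∈ range (m + 1) | s * (s + 1) / 2 = m}

theorem triangularCount_zero : triangularCount 0 = 1 := rfl

theorem hasSum_triangularCount (hq : ‖q‖ < 1) :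
    HasSum (fun m => ((triangularCount m : ℝ) : ℂ) * q ^ m)
      (pochInf (q ^ 2) (q ^ 2) ^ 2 / pochInf q q) := by
  have := hasSum_pow_of_fibers (fun s : ℕ => s * (s + 1) / 2) (fun _ => 1)
    (fun m => {s ∈ range (m + 1) | s * (s + 1) / 2 = m}) ?_
    ((hasSum_triangular hq).congr_fun fun s => one_mul _)
  · simpa [triangularCount] using this
  · intro m s
    simp only [Finset.mem_filter, Finset.mem_range, and_iff_right_iff_imp]
    intro h
    rw [Nat.lt_succ_iff, ← h, Nat.le_div_iff_mul_le two_pos]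
    rcases s with _ | s
    · simp
    · exact Nat.mul_le_mul_left _ (by omega)

end

end KanekoKoike

namespace KanekoKoike

open Finset Filter Topology
open scoped UpperHalfPlane

/-! ### Fourier expansions as power series -/

/-- `f = q^r p(q)` with a real power series `p`. -/
def Expands (f : ℍ → ℂ) (r : ℝ) (p : PowerSeries ℝ) : Prop :=
  HasFourierExpansion f r fun n => PowerSeries.coeff n p

/-- `q = e^{2πiτ}`. -/
noncomputable def nome (τ : ℍ) : ℂ := Complex.exp (2 * Real.pi * Complex.I * (τ : ℂ))

theorem nome_ne_zero (τ : ℍ) : nome τ ≠ 0 := Complex.exp_ne_zero _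

theorem norm_nome_lt_one (τ : ℍ) : ‖nome τ‖ < 1 := UpperHalfPlane.norm_exp_two_pi_I_lt_one τ

theorem exp_add_nat (r : ℂ) (n : ℕ) (τ : ℍ) :
    Complex.exp (2 * Real.pi * Complex.I * (r + n) * (τ : ℂ)) =
      Complex.exp (2 * Real.pi * Complex.I * r * (τ : ℂ)) * nome τ ^ n := by
  rw [nome, ← Complex.exp_nat_mul, ← Complex.exp_add]
  congr 1; ring

theorem hasFourierExpansion_of_hasSum {f : ℍ → ℂ} {r : ℝ} {c : ℕ → ℝ} {S : ℍ → ℂ}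
    (hS : ∀ τ, HasSum (fun n => (c n : ℂ) * nome τ ^ n) (S τ))
    (hf : ∀ τ : ℍ, f τ = Complex.exp (2 * Real.pi * Complex.I * r * (τ : ℂ)) * S τ) :
    HasFourierExpansion f r c := by
  intro τ
  rw [hf]
  refine ((hS τ).mul_left _).congr_fun fun n => ?_
  rw [exp_add_nat]; ring

theorem HasFourierExpansion.expands {f : ℍ → ℂ} {r : ℝ} {c : ℕ → ℝ}
    (h : HasFourierExpansion f r c) : Expands f r (PowerSeries.mk c) := by
  simpa only [Expands, PowerSeries.coeff_mk] using h

namespace Expands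

variable {f g : ℍ → ℂ} {r s : ℝ} {p p' : PowerSeries ℝ}

theorem mul (hf : Expands f r p) (hg : Expands g s p') :
    Expands (fun τ => f τ * g τ) (r + s) (p * p') := by
  intro τ
  have h1 := hf τ
  have h2 := hg τ
  have h3 := (summable_norm_sum_mul_antidiagonal_of_summable_norm h1.summable.norm
    h2.summable.norm).of_norm.hasSum
  rw [← tsum_mul_tsum_eq_tsum_sum_antidiagonal_of_summable_norm h1.summable.norm h2.summable.norm,
    h1.tsum_eq, h2.tsum_eq] at h3
  refine h3.congr_fun fun n => ?_
  beta_reduce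
  rw [PowerSeries.coeff_mul, Complex.ofReal_sum, Finset.sum_mul]
  refine Finset.sum_congr rfl fun ij hij => ?_
  rw [← Finset.HasAntidiagonal.mem_antidiagonal.mp hij, mul_mul_mul_comm, ← Complex.exp_add, Complex.ofReal_mul]
  congr 2
  push_cast; ring

theorem one : Expands (fun _ => 1) 0 1 := by
  intro τ
  convert hasSum_ite_eq (0 : ℕ) (1 : ℂ) using 2 with n
  beta_reduce
  rw [PowerSeries.coeff_one]
  split_ifs with h <;> simp [h]

theorem of_eq (hf : Expands f r p) (hfg : ∀ τ, g τ = f τ) (hr : s = r) : Expands g s p := by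
  rw [hr, show g = f from funext hfg]; exact hf

theorem pow (hf : Expands f r p) (n : ℕ) : Expands (fun τ => f τ ^ n) (n * r) (p ^ n) := by
  induction n with
  | zero => simpa using one
  | succ n ih =>
    rw [pow_succ]
    exact (ih.mul hf).of_eq (fun τ => pow_succ _ _) (by push_cast; ring)

theorem pow_zero_exp (hf : Expands f 0 p) (n : ℕ) : Expands (fun τ => f τ ^ n) 0 (p ^ n) :=
  (hf.pow n).of_eq (fun _ => rfl) (by simp)

theorem const_mul (hf : Expands f r p) (a : ℝ) :
    Expands (fun τ => (a : ℂ) * f τ) r (PowerSeries.C a * p) := by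
  intro τ
  refine ((hf τ).mul_left (a : ℂ)).congr_fun fun n => ?_
  beta_reduce
  rw [PowerSeries.coeff_C_mul]; push_cast; ring

theorem sum {ι : Type*} (t : Finset ι) {F : ι → ℍ → ℂ} {P : ι → PowerSeries ℝ}
    (h : ∀ i ∈ t, Expands (F i) r (P i)) : Expands (fun τ => ∑ i ∈ t, F i τ) r (∑ i ∈ t, P i) := by
  intro τ
  refine (hasSum_sum fun i hi => h i hi τ).congr_fun fun n => ?_
  beta_reduce
  rw [map_sum, Complex.ofReal_sum, Finset.sum_mul]

/-- A full power of q moves into the power series, so that Δ and the Eisenstein series share the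
exponent 0. -/
theorem shift (hf : Expands f (r + 1) p) : Expands f r (PowerSeries.X * p) := by
  intro τ
  rw [← hasSum_nat_add_iff' 1]
  simp only [Finset.sum_range_one, PowerSeries.coeff_zero_X_mul, Complex.ofReal_zero, zero_mul,
    sub_zero]
  refine (hf τ).congr_fun fun n => ?_
  rw [PowerSeries.coeff_succ_X_mul]
  congr 2
  push_cast; ring

/-- The expansion of `∑ a_i R D^i E^{e_i}`. -/
theorem sum_mul_pow {R D E : ℍ → ℂ} {P Dp Ep : PowerSeries ℝ} (hR : Expands R r P)
    (hD : Expands D 0 Dp) (hE : Expands E 0 Ep) (a : ℕ → ℝ) (e : ℕ → ℕ) (N : ℕ) :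
    Expands (fun τ => ∑ i ∈ range N, (a i : ℂ) * (R τ * D τ ^ i) * E τ ^ e i) r
      (P * ∑ i ∈ range N, PowerSeries.C (a i) * (Dp ^ i * Ep ^ e i)) := by
  have h : ∀ i ∈ range N, Expands (fun τ => (a i : ℂ) * (D τ ^ i * E τ ^ e i)) 0
      (PowerSeries.C (a i) * (Dp ^ i * Ep ^ e i)) := fun i _ =>
    (((hD.pow_zero_exp i).mul (hE.pow_zero_exp (e i))).of_eq (fun _ => rfl)
      (add_zero 0).symm).const_mul (a i)
  refine (hR.mul (sum _ h)).of_eq (fun τ => ?_) (add_zero r).symm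
  rw [Finset.mul_sum]
  exact Finset.sum_congr rfl fun i _ => by ring

end Expands

/-! ### Power series with nonnegative coefficients -/

section
variable {p p' : PowerSeries ℝ}

/-- All coefficients are nonnegative. -/
def CoeffNonneg (p : PowerSeries ℝ) : Prop := ∀ n, 0 ≤ PowerSeries.coeff n p

/-- All coefficients are positive. -/
def CoeffPos (p : PowerSeries ℝ) : Prop := ∀ n, 0 < PowerSeries.coeff n p

theorem CoeffPos.nonneg (h : CoeffPos p) : CoeffNonneg p := fun n => (h n).le

theorem CoeffNonneg.mul (h : CoeffNonneg p) (h' : CoeffNonneg p') : CoeffNonneg (p * p') :=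
  fun n => by
    rw [PowerSeries.coeff_mul]
    exact Finset.sum_nonneg fun ij _ => mul_nonneg (h _) (h' _)

theorem CoeffNonneg.one : CoeffNonneg 1 := fun n => by
  rw [PowerSeries.coeff_one]; split_ifs <;> norm_num

theorem CoeffNonneg.pow (h : CoeffNonneg p) (n : ℕ) : CoeffNonneg (p ^ n) := by
  induction n with
  | zero => simpa using CoeffNonneg.one
  | succ n ih => rw [pow_succ]; exact ih.mul h

theorem CoeffNonneg.X_mul (h : CoeffNonneg p) : CoeffNonneg (PowerSeries.X * p) := by
  rintro (_ | n)
  · rw [PowerSeries.coeff_zero_X_mul]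
  · rw [PowerSeries.coeff_succ_X_mul]; exact h n

theorem CoeffNonneg.C_mul (h : CoeffNonneg p) {a : ℝ} (ha : 0 ≤ a) :
    CoeffNonneg (PowerSeries.C a * p) := fun n => by
  rw [PowerSeries.coeff_C_mul]; exact mul_nonneg ha (h n)

theorem CoeffNonneg.sum {ι : Type*} {t : Finset ι} {P : ι → PowerSeries ℝ}
    (h : ∀ i ∈ t, CoeffNonneg (P i)) : CoeffNonneg (∑ i ∈ t, P i) := fun n => by
  rw [map_sum]; exact Finset.sum_nonneg fun i hi => h i hi n

theorem CoeffPos.add_nonneg (h : CoeffPos p) (h' : CoeffNonneg p') : CoeffPos (p + p') := fun n => by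
  rw [map_add]; exact add_pos_of_pos_of_nonneg (h n) (h' n)

/-- The constant term of the second factor keeps every coefficient of the first alive, so a single
strictly positive factor suffices. -/
theorem CoeffPos.mul (h : CoeffPos p) (h' : CoeffNonneg p') (h0 : PowerSeries.coeff 0 p' = 1) :
    CoeffPos (p * p') := fun n => by
  rw [PowerSeries.coeff_mul]
  refine Finset.sum_pos' (fun ij _ => mul_nonneg (h _).le (h' _))
    ⟨(n, 0), by simp, ?_⟩
  simp only [h0, mul_one]
  exact h n

theorem coeff_zero_pow (h : PowerSeries.coeff 0 p = 1) (n : ℕ) : PowerSeries.coeff 0 (p ^ n) = 1 := by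
  rw [PowerSeries.coeff_zero_eq_constantCoeff_apply] at h ⊢
  rw [map_pow, h, one_pow]

theorem coeff_zero_mul (h : PowerSeries.coeff 0 p = 1) (h' : PowerSeries.coeff 0 p' = 1) :
    PowerSeries.coeff 0 (p * p') = 1 := by
  rw [PowerSeries.coeff_zero_eq_constantCoeff_apply] at h h' ⊢
  rw [map_mul, h, h', one_mul]

theorem coeff_zero_sum {D E : PowerSeries ℝ} (hD : PowerSeries.coeff 0 D = 0)
    (hE : PowerSeries.coeff 0 E = 1) {a : ℕ → ℝ} (ha : a 0 = 1) (e : ℕ → ℕ) (N : ℕ) :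
    PowerSeries.coeff 0 (∑ i ∈ range (N + 1), PowerSeries.C (a i) * (D ^ i * E ^ e i)) = 1 := by
  rw [PowerSeries.coeff_zero_eq_constantCoeff_apply] at hD hE ⊢
  rw [map_sum, Finset.sum_range_succ']
  simp [hD, hE, ha]

theorem coeffNonneg_sum {D E : PowerSeries ℝ} (hD : CoeffNonneg D) (hE : CoeffNonneg E) {a : ℕ → ℝ}
    {N : ℕ} (ha : ∀ i < N, 0 ≤ a i) (e : ℕ → ℕ) :
    CoeffNonneg (∑ i ∈ range N, PowerSeries.C (a i) * (D ^ i * E ^ e i)) :=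
  CoeffNonneg.sum fun i hi => ((hD.pow i).mul (hE.pow _)).C_mul (ha i (Finset.mem_range.mp hi))

end

/-! ### Expansions of the modular forms -/

theorem eta_nat_mul (N : ℕ) (τ : ℍ) :
    ModularForm.eta ((N : ℂ) * (τ : ℂ)) =
      Complex.exp (2 * Real.pi * Complex.I * (τ : ℂ) * (N / 24)) *
        pochInf (nome τ ^ N) (nome τ ^ N) := by
  rw [ModularForm.eta, pochInf]
  congr 1
  · rw [Function.Periodic.qParam]; congr 1; push_cast; ring
  · have h : Complex.exp (2 * Real.pi * Complex.I * ((N : ℂ) * (τ : ℂ))) = nome τ ^ N := by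
      rw [nome, ← Complex.exp_nat_mul]; congr 1; ring
    refine tprod_congr fun n => ?_
    rw [ModularForm.eta_q_eq_pow, ← pow_succ', h]

/-- Serves to substitute q^N for q and multiply by q^a at the level of coefficients. -/
theorem hasSum_spread {c : ℕ → ℝ} {q S : ℂ} {N : ℕ} (hN : 0 < N) (a : ℕ)
    (h : HasSum (fun n => (c n : ℂ) * (q ^ N) ^ n) S) :
    HasSum (fun n => ((if a ≤ n ∧ N ∣ n - a then c ((n - a) / N) else 0 : ℝ) : ℂ) * q ^ n)
      (q ^ a * S) := by
  have := hasSum_pow_of_fibers (fun n => N * n + a) (fun n => (c n : ℂ))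
    (fun n => if a ≤ n ∧ N ∣ n - a then {(n - a) / N} else ∅) (q := q) (S := q ^ a * S) ?_ ?_
  · refine this.congr_fun fun n => ?_
    split_ifs <;> simp
  · intro m n
    split_ifs with h
    · rw [Finset.mem_singleton]
      obtain ⟨h1, k, hk⟩ := h
      rw [hk, Nat.mul_div_cancel_left _ hN]
      constructor
      · rintro rfl; omega
      · intro h2
        exact Nat.eq_of_mul_eq_mul_left hN (by omega)
    · simp only [Finset.notMem_empty, false_iff]
      intro h2
      exact h ⟨by omega, n, by omega⟩
  · refine (h.mul_left (q ^ a)).congr_fun fun n => ?_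
    rw [pow_add, pow_mul]; ring

end KanekoKoike

namespace KanekoKoike

open Finset Polynomial

/-! ### Hypergeometric coefficients -/

theorem hypCoeff_zero_right (a b c : ℝ) : ordinaryHypergeometricCoefficient a b c 0 = 1 := by
  simp [ordinaryHypergeometricCoefficient]

theorem ascPochhammer_mul_nonneg {a b : ℝ} {i : ℕ} (ha : ∀ j < i, a + j ≤ 0)
    (hb : ∀ j < i, b + j ≤ 0) : 0 ≤ (ascPochhammer ℝ i).eval a * (ascPochhammer ℝ i).eval b := by
  induction i with
  | zero => simp
  | succ i ih =>
    rw [ascPochhammer_succ_eval, ascPochhammer_succ_eval, mul_mul_mul_comm]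
    exact mul_nonneg (ih (fun j hj => ha j (by omega)) fun j hj => hb j (by omega))
      (mul_nonneg_of_nonpos_of_nonpos (ha i (by omega)) (hb i (by omega)))

theorem hypCoeff_nonneg {a b c : ℝ} {i : ℕ} (ha : ∀ j < i, a + j ≤ 0) (hb : ∀ j < i, b + j ≤ 0)
    (hc : 0 < c) : 0 ≤ ordinaryHypergeometricCoefficient a b c i := by
  have h1 := ascPochhammer_mul_nonneg ha hb
  have h2 := ascPochhammer_pos i c hc
  rw [ordinaryHypergeometricCoefficient, mul_assoc ((i.factorial : ℝ)⁻¹)]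
  positivity

theorem ascPochhammer_eval_neg_nat (n i : ℕ) :
    (ascPochhammer ℝ i).eval (-(n : ℝ)) = (-1) ^ i * (i.factorial * n.choose i) := by
  rw [ascPochhammer_eval_neg_eq_descPochhammer, descPochhammer_eval_eq_descFactorial,
    Nat.descFactorial_eq_factorial_mul_choose, Nat.cast_mul]

/-- The linear functional on polynomials with moments `X^i ↦ (b)_i / (c)_i`. -/
noncomputable def momentFunctional (b c : ℝ) : ℂ[X] →ₗ[ℂ] ℂ :=
  (Polynomial.basisMonomials ℂ).constr ℂ fun i =>
    (((ascPochhammer ℝ i).eval b / (ascPochhammer ℝ i).eval c : ℝ) : ℂ)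

theorem momentFunctional_X_pow (b c : ℝ) (i : ℕ) : momentFunctional b c (X ^ i) =
    (((ascPochhammer ℝ i).eval b / (ascPochhammer ℝ i).eval c : ℝ) : ℂ) := by
  rw [momentFunctional, ← Polynomial.monomial_one_right_eq_X_pow,
    ← congrFun (Polynomial.coe_basisMonomials ℂ) i, Module.Basis.constr_basis]

theorem momentFunctional_C_mul (b c : ℝ) (a : ℂ) (p : ℂ[X]) :
    momentFunctional b c (C a * p) = a * momentFunctional b c p := by
  rw [← smul_eq_C_mul, map_smul, smul_eq_mul]

/-- Formally this is integration by parts against the beta density t^(b-1) (1-t)^(c-b-1). The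
integral may diverge, as b is negative in the application with n ≥ 1, so the relation is checked on
monomials. -/
theorem momentFunctional_relation {b c : ℝ} (hc : 0 < c) (p : ℂ[X]) :
    momentFunctional b c ((C (c : ℂ) * X - C (b : ℂ)) * p + X * (X - 1) * derivative p) = 0 := by
  induction p using Polynomial.induction_on' with
  | add p p' h h' =>
    have e : (C (c : ℂ) * X - C (b : ℂ)) * (p + p') + X * (X - 1) * derivative (p + p') =
        ((C (c : ℂ) * X - C (b : ℂ)) * p + X * (X - 1) * derivative p) +
        ((C (c : ℂ) * X - C (b : ℂ)) * p' + X * (X - 1) * derivative p') := by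
      rw [derivative_add]; ring
    rw [e, map_add, h, h', add_zero]
  | monomial i a =>
    have e : (C (c : ℂ) * X - C (b : ℂ)) * monomial i a + X * (X - 1) * derivative (monomial i a) =
        C (a * (c + i)) * X ^ (i + 1) - C (a * (b + i)) * X ^ i := by
      rw [← C_mul_X_pow_eq_monomial, derivative_C_mul_X_pow]
      rcases i with _ | i
      · simp; ring
      · simp only [Nat.add_sub_cancel, C_mul, C_add]
        ring
    rw [e, map_sub, momentFunctional_C_mul, momentFunctional_C_mul, momentFunctional_X_pow,
      momentFunctional_X_pow, ascPochhammer_succ_eval, ascPochhammer_succ_eval]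
    have h1 : (((ascPochhammer ℝ i).eval c : ℝ) : ℂ) ≠ 0 :=
      Complex.ofReal_ne_zero.mpr (ascPochhammer_pos i c hc).ne'
    have h2 : (c : ℂ) + i ≠ 0 := by
      have : c + i ≠ 0 := by positivity
      exact_mod_cast this
    push_cast
    field_simp
    ring

theorem momentFunctional_recurrence_zero {b c : ℝ} (hc : 0 < c) :
    c * momentFunctional b c (1 - 2 * X) = (c - 2 * b) * momentFunctional b c 1 := by
  have h := momentFunctional_relation (b := b) hc 1
  have e : (C (c : ℂ) * X - C (b : ℂ)) * 1 + X * (X - 1) * derivative 1 =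
      C ((c - 2 * b) / 2 : ℂ) * 1 - C (c / 2 : ℂ) * (1 - 2 * X) := by
    have : (C (c : ℂ)) = C (c / 2 : ℂ) * 2 := by
      rw [← C_ofNat, ← C_mul]; congr 1; ring
    rw [derivative_one, sub_div, C_sub, mul_div_cancel_left₀ _ two_ne_zero, this]
    ring
  rw [e, map_sub, momentFunctional_C_mul, momentFunctional_C_mul] at h
  linear_combination -2 * h

/-- In terms of u = 1 - 2X one has X(X-1) = (u² - 1)/4, so the relation applied to u^(j+1) involves
only three consecutive powers of u. -/
theorem momentFunctional_recurrence_succ {b c : ℝ} (hc : 0 < c) (j : ℕ) :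
    (c + (j + 1)) * momentFunctional b c ((1 - 2 * X) ^ (j + 2)) =
      (c - 2 * b) * momentFunctional b c ((1 - 2 * X) ^ (j + 1)) +
        (j + 1) * momentFunctional b c ((1 - 2 * X) ^ j) := by
  have h := momentFunctional_relation (b := b) hc ((1 - 2 * X) ^ (j + 1))
  have hd : derivative ((1 - 2 * X : ℂ[X]) ^ (j + 1)) = C ((j : ℂ) + 1) * (1 - 2 * X) ^ j * (-2) := by
    rw [derivative_pow_succ]
    simp
  have e : (C (c : ℂ) * X - C (b : ℂ)) * (1 - 2 * X) ^ (j + 1) +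
      X * (X - 1) * derivative ((1 - 2 * X) ^ (j + 1)) =
      C ((c - 2 * b) / 2 : ℂ) * (1 - 2 * X) ^ (j + 1) + C ((j + 1) / 2 : ℂ) * (1 - 2 * X) ^ j
        - C ((c + (j + 1)) / 2 : ℂ) * (1 - 2 * X) ^ (j + 2) := by
    have h1 : (C (c : ℂ)) = C (c / 2 : ℂ) * 2 := by
      rw [← C_ofNat, ← C_mul]; congr 1; ring
    have h2 : (C ((j : ℂ) + 1)) = C ((j + 1) / 2 : ℂ) * 2 := by
      rw [← C_ofNat, ← C_mul]; congr 1; ring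
    have h3 : C ((c - 2 * b) / 2 : ℂ) = C (c / 2 : ℂ) - C (b : ℂ) := by
      rw [← C_sub]; congr 1; ring
    have h4 : C ((c + (j + 1)) / 2 : ℂ) = C (c / 2 : ℂ) + C ((j + 1) / 2 : ℂ) := by
      rw [← C_add]; congr 1; ring
    rw [hd, h1, h2, h3, h4]
    ring
  rw [e, map_sub, map_add, momentFunctional_C_mul, momentFunctional_C_mul,
    momentFunctional_C_mul] at h
  linear_combination -2 * h

theorem momentFunctional_one (b c : ℝ) : momentFunctional b c 1 = 1 := by
  simpa using momentFunctional_X_pow b c 0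

theorem exists_pos_moment {b c : ℝ} (hc : 0 < c) (hbc : 0 < c - 2 * b) (j : ℕ) :
    ∃ s : ℝ, 0 < s ∧ momentFunctional b c ((1 - 2 * X) ^ j) = s := by
  induction j using Nat.strong_induction_on with
  | _ j ih =>
    rcases j with _ | _ | j
    · exact ⟨1, one_pos, by simp [momentFunctional_one]⟩
    · refine ⟨(c - 2 * b) / c, by positivity, ?_⟩
      have h := momentFunctional_recurrence_zero (b := b) hc
      have hc' : (c : ℂ) ≠ 0 := Complex.ofReal_ne_zero.mpr hc.ne'
      rw [momentFunctional_one] at h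
      push_cast
      rw [pow_one, eq_div_iff hc']
      linear_combination h
    · obtain ⟨s, hs, hs'⟩ := ih j (by omega)
      obtain ⟨t, ht, ht'⟩ := ih (j + 1) (by omega)
      have h := momentFunctional_recurrence_succ (b := b) hc j
      rw [hs', ht'] at h
      refine ⟨((c - 2 * b) * t + (j + 1) * s) / (c + (j + 1)), by positivity, ?_⟩
      have hc' : (c : ℂ) + (j + 1) ≠ 0 := by
        have : c + (j + 1) ≠ 0 := by positivity
        exact_mod_cast this
      push_cast
      rw [eq_div_iff hc', ← h]
      ring

/-- Re-expansion of a terminating hypergeometric polynomial, made homogeneous in `w` and `H + w`,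
in powers of `w` and `H`; the new coefficients are positive. -/
theorem exists_pos_reexpansion {b c : ℝ} (hc : 0 < c) (hbc : 0 < c - 2 * b) (n : ℕ) :
    ∃ s : ℕ → ℝ, (∀ j, 0 < s j) ∧ s 0 = 1 ∧ ∀ H w : ℂ,
      ∑ i ∈ range (n + 1), hypCoeff (-(n : ℝ)) b c i * (2 * w) ^ i * (H + w) ^ (n - i) =
        ∑ j ∈ range (n + 1), (n.choose j * s j : ℝ) * w ^ j * H ^ (n - j) := by
  choose s hs hs' using exists_pos_moment hc hbc
  refine ⟨s, hs, ?_, fun H w => ?_⟩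
  · have := hs' 0
    rw [pow_zero, momentFunctional_one] at this
    exact_mod_cast this.symm
  -- One linear polynomial grouped in two ways: the functional applied to the two binomial
  -- expansions gives the two sides.
  have e : (C (-(2 * w)) * X + C (H + w)) ^ n = (C w * (1 - 2 * X) + C H) ^ n := by
    congr 1
    rw [C_neg, C_mul, C_add, C_ofNat]; ring
  have h := congrArg (momentFunctional b c) e
  rw [add_pow, add_pow, map_sum, map_sum] at h
  refine (Finset.sum_congr rfl fun i hi => ?_).trans (h.trans (Finset.sum_congr rfl fun i hi => ?_))
  · have e1 : (C (-(2 * w)) * X) ^ i * C (H + w) ^ (n - i) * (n.choose i : ℂ[X]) =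
        C ((-(2 * w)) ^ i * (H + w) ^ (n - i) * n.choose i) * X ^ i := by
      simp only [C_mul, C_pow, C_eq_natCast]; ring
    rw [e1, momentFunctional_C_mul, momentFunctional_X_pow, hypCoeff,
      ordinaryHypergeometricCoefficient, ascPochhammer_eval_neg_nat]
    have : (i.factorial : ℂ) ≠ 0 := by exact_mod_cast i.factorial_ne_zero
    rw [neg_pow (2 * w)]
    push_cast
    field_simp
  · have e1 : (C w * (1 - 2 * X)) ^ i * C H ^ (n - i) * (n.choose i : ℂ[X]) =
        C (w ^ i * H ^ (n - i) * n.choose i) * (1 - 2 * X) ^ i := by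
      simp only [C_mul, C_pow, C_eq_natCast, mul_pow]; ring
    rw [e1, momentFunctional_C_mul, hs']
    push_cast; ring

end KanekoKoike

/-! ### Fourier expansions of the eta quotients and Eisenstein series. -/

namespace KanekoKoike

open Finset Filter Topology
open scoped UpperHalfPlane

theorem eta_quotient (N M a b : ℕ) {r : ℝ} (hr : (N : ℝ) * a - M * b = 24 * r) (τ : ℍ) :
    ModularForm.eta ((N : ℂ) * (τ : ℂ)) ^ a / ModularForm.eta ((M : ℂ) * (τ : ℂ)) ^ b =
      Complex.exp (2 * Real.pi * Complex.I * r * (τ : ℂ)) *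
        (pochInf (nome τ ^ N) (nome τ ^ N) ^ a / pochInf (nome τ ^ M) (nome τ ^ M) ^ b) := by
  rw [eta_nat_mul, eta_nat_mul, mul_pow, mul_pow, mul_div_mul_comm, ← Complex.exp_nat_mul,
    ← Complex.exp_nat_mul, ← Complex.exp_sub]
  congr 2
  have : (r : ℂ) = ((N : ℂ) * a - M * b) / 24 := by
    have h : r = ((N : ℝ) * a - M * b) / 24 := by linarith
    rw [h]; push_cast; ring
  rw [this]; ring

theorem Delta42Root_expands :
    Expands Delta42Root (1 / 2) (PowerSeries.mk fun m => (ArithmeticFunction.sigma 1 (2 * m + 1) : ℝ)) := by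
  have h := (hasFourierExpansion_of_hasSum (r := 1 / 2) (f := Delta42Root)
    (fun τ => hasSum_eulerProd_two (nome_ne_zero τ) (norm_nome_lt_one τ)) fun τ => ?_).expands
  · rwa [funext doubleCoeff_two] at h
  · have := eta_quotient 2 1 8 4 (r := 1 / 2) (by norm_num) τ
    simpa [Delta42Root] using this

theorem Delta33Root_expands :
    Expands Delta33Root (1 / 3) (PowerSeries.mk fun m =>
      ((∑ d ∈ (3 * m + 1).divisors, legendreSym 3 (d : ℤ) : ℤ) : ℝ)) := by
  have h := (hasFourierExpansion_of_hasSum (r := 1 / 3) (f := Delta33Root)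
    (fun τ => hasSum_eulerProd_three (nome_ne_zero τ) (norm_nome_lt_one τ)) fun τ => ?_).expands
  · simpa only [doubleCoeff_three] using h
  · have := eta_quotient 3 1 3 1 (r := 1 / 3) (by norm_num) τ
    simpa [Delta33Root] using this

/-- The root has vanishing coefficients (for instance at m = 3, from 3m+1 = 10), so strict
positivity at level 3 has to come from its square. -/
theorem Delta33Root_sq_expands : ∃ p : PowerSeries ℝ, CoeffPos p ∧ PowerSeries.coeff 0 p = 1 ∧
    Expands (fun τ => Delta33Root τ ^ 2) (2 / 3) p := by
  refine ⟨_, ?_, ?_, (hasFourierExpansion_of_hasSum (r := 2 / 3)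
    (fun τ => hasSum_eulerProd_three_sq (nome_ne_zero τ) (norm_nome_lt_one τ)) fun τ => ?_).expands⟩
  · intro m
    rw [PowerSeries.coeff_mk]
    refine add_pos_of_pos_of_nonneg ?_ (doubleCoeff_nonneg (fun j => by positivity) _ _ _)
    -- The summand l = 0 of the first series is 1/(1-q)², which reaches every exponent.
    refine Finset.sum_pos' (fun p _ => by positivity) ⟨(0, m), ?_, by positivity⟩
    simp
  · rw [PowerSeries.coeff_mk]
    simp [doubleCoeff, Finset.filter_singleton]
  · have := eta_quotient 3 1 3 1 (r := 1 / 3) (by norm_num) τ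
    have h2 : Delta33Root τ = Complex.exp (2 * Real.pi * Complex.I * (1 / 3 : ℝ) * (τ : ℂ)) *
        (pochInf (nome τ ^ 3) (nome τ ^ 3) ^ 3 / pochInf (nome τ) (nome τ)) := by
      simpa [Delta33Root] using this
    rw [h2, mul_pow, ← Complex.exp_nat_mul]
    congr 2
    push_cast; ring

theorem Delta24Root_expands : ∃ p : PowerSeries ℝ, CoeffNonneg p ∧ PowerSeries.coeff 0 p = 1 ∧
    Expands Delta24Root (1 / 4) p := by
  refine ⟨_, ?_, ?_, (hasFourierExpansion_of_hasSum (r := 1 / 4)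
    (fun τ => hasSum_spread two_pos 0
      (hasSum_triangularCount (norm_pow_lt_one (norm_nome_lt_one τ) two_ne_zero))) fun τ => ?_).expands⟩
  · intro m
    rw [PowerSeries.coeff_mk]
    split_ifs <;> positivity
  · simp [triangularCount_zero]
  · have := eta_quotient 4 2 2 1 (r := 1 / 4) (by norm_num) τ
    rw [pow_zero, one_mul, ← pow_mul]
    simpa [Delta24Root] using this

/-- The coefficients of `Δ_2^{(4)}`. -/
noncomputable def oddSigma (n : ℕ) : ℝ := if Odd n then (ArithmeticFunction.sigma 1 n : ℝ) else 0

/-- This form is q times the level 2 product series evaluated at q², which leaves only odd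
exponents. -/
theorem Delta24_expansion : HasFourierExpansion Delta24 0 oddSigma := by
  have h := hasFourierExpansion_of_hasSum (r := 0) (f := Delta24)
    (fun τ => hasSum_spread two_pos 1 (hasSum_eulerProd_two (pow_ne_zero 2 (nome_ne_zero τ))
      (norm_pow_lt_one (norm_nome_lt_one τ) two_ne_zero))) fun τ => ?_
  · convert h using 2 with n
    rw [oddSigma, doubleCoeff_two]
    by_cases hn : Odd n
    · obtain ⟨k, rfl⟩ := hn
      have : (2 * k + 1 - 1) / 2 = k := by omega
      rw [if_pos ⟨k, rfl⟩, if_pos ⟨by omega, by omega⟩, this]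
    · rw [if_neg hn, if_neg]
      rintro ⟨h1, k, hk⟩
      exact hn ⟨k, by omega⟩
  · have := eta_quotient 4 2 8 4 (r := 1) (by norm_num) τ
    rw [← pow_mul]
    simp only [Complex.ofReal_zero, mul_zero, zero_mul, Complex.exp_zero, one_mul, pow_one]
    simpa [Delta24, nome] using this

/-! ### Eisenstein series -/

theorem nome_scale (N : ℕ) (hN : 0 < N) (τ : ℍ) : nome (scale N hN τ) = nome τ ^ N := by
  rw [nome, nome, ← Complex.exp_nat_mul]
  congr 1
  change 2 * Real.pi * Complex.I * ((N : ℂ) * (τ : ℂ)) = _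
  ring

/-- The coefficients of `E_2`. -/
noncomputable def e2Coeff (n : ℕ) : ℝ := if n = 0 then 1 else -24 * ArithmeticFunction.sigma 1 n

theorem hasSum_E2 (τ : ℍ) :
    HasSum (fun n => (e2Coeff n : ℂ) * nome τ ^ n) (EisensteinSeries.E2 τ) := by
  refine (EisensteinSeries.hasSum_qExpansion_E2 (z := τ)).congr_fun fun n => ?_
  rw [e2Coeff, smul_eq_mul, nome]
  split_ifs <;> push_cast <;> rfl

/-- The coefficients of `(N E_2(Nτ) - E_2(τ)) / (N - 1)`. -/
noncomputable def eisCoeff (N n : ℕ) : ℝ :=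
  (N * (if N ∣ n then e2Coeff (n / N) else 0) - e2Coeff n) / (N - 1)

theorem hasFourierExpansion_eis {N : ℕ} (hN : 0 < N) :
    HasFourierExpansion (fun τ => ((N : ℂ) * EisensteinSeries.E2 (scale N hN τ) -
      EisensteinSeries.E2 τ) / (N - 1)) 0 (eisCoeff N) := by
  refine hasFourierExpansion_of_hasSum (S := fun τ => ((N : ℂ) *
    EisensteinSeries.E2 (scale N hN τ) - EisensteinSeries.E2 τ) / (N - 1)) (fun τ => ?_)
    fun τ => by simp
  have h := hasSum_E2 (scale N hN τ)
  rw [nome_scale] at h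
  have h' := hasSum_spread hN 0 h
  rw [pow_zero, one_mul] at h'
  refine (((h'.mul_left (N : ℂ)).sub (hasSum_E2 τ)).div_const ((N : ℂ) - 1)).congr_fun fun n => ?_
  rw [eisCoeff]
  simp only [Nat.zero_le, true_and, Nat.sub_zero]
  push_cast
  ring

/-- Multiplication by N embeds the divisors of m into those of Nm and misses the divisor 1. -/
theorem mul_sigma_lt_sigma_mul {N m : ℕ} (hN : 2 ≤ N) (hm : 0 < m) :
    N * ArithmeticFunction.sigma 1 m < ArithmeticFunction.sigma 1 (N * m) := by
  rw [ArithmeticFunction.sigma_one_apply, ArithmeticFunction.sigma_one_apply, Finset.mul_sum]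
  have hNm : N * m ≠ 0 := by positivity
  have h1 : 1 ∈ (N * m).divisors := Nat.one_mem_divisors.mpr hNm
  rw [← Finset.add_sum_erase _ _ h1]
  have h2 : ∑ d ∈ m.divisors, N * d = ∑ d ∈ m.divisors.image (N * ·), d := by
    rw [Finset.sum_image]
    intro a _ b _ h
    exact Nat.eq_of_mul_eq_mul_left (by omega) h
  have h3 : m.divisors.image (N * ·) ⊆ (N * m).divisors.erase 1 := by
    intro d hd
    obtain ⟨e, he, rfl⟩ := Finset.mem_image.mp hd
    rw [Finset.mem_erase, Nat.mem_divisors]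
    have he0 := Nat.pos_of_mem_divisors he
    exact ⟨by nlinarith, Nat.mul_dvd_mul_left _ (Nat.dvd_of_mem_divisors he), hNm⟩
  have := Finset.sum_le_sum_of_subset (f := fun d => d) h3
  omega

theorem eisCoeff_zero {N : ℕ} (hN : 2 ≤ N) : eisCoeff N 0 = 1 := by
  have : (N : ℝ) - 1 ≠ 0 := by
    have : (2 : ℝ) ≤ N := by exact_mod_cast hN
    linarith
  simp [eisCoeff, e2Coeff, this]

theorem eisCoeff_pos {N : ℕ} (hN : 2 ≤ N) (n : ℕ) : 0 < eisCoeff N n := by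
  rcases Nat.eq_zero_or_pos n with rfl | hn
  · rw [eisCoeff_zero hN]; exact one_pos
  have hN' : (2 : ℝ) ≤ N := by exact_mod_cast hN
  refine div_pos ?_ (by linarith)
  have hσ : 0 < ArithmeticFunction.sigma 1 n := ArithmeticFunction.sigma_pos 1 n hn.ne'
  have hσ' : (0 : ℝ) < ArithmeticFunction.sigma 1 n := by exact_mod_cast hσ
  split_ifs with h
  · obtain ⟨m, rfl⟩ := h
    have hm : 0 < m := Nat.pos_of_mul_pos_left hn
    rw [Nat.mul_div_cancel_left _ (by omega), e2Coeff, e2Coeff, if_neg hm.ne', if_neg hn.ne']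
    have : (N : ℝ) * ArithmeticFunction.sigma 1 m < ArithmeticFunction.sigma 1 (N * m) := by
      exact_mod_cast mul_sigma_lt_sigma_mul hN hm
    linarith
  · rw [e2Coeff, if_neg hn.ne']
    linarith

theorem eisCoeff_four_of_odd {n : ℕ} (hn : Odd n) :
    eisCoeff 4 n = 8 * ArithmeticFunction.sigma 1 n := by
  have h1 : ¬ 4 ∣ n := fun h => by
    obtain ⟨k, rfl⟩ := hn
    omega
  have h2 : n ≠ 0 := by rintro rfl; simp at hn
  rw [eisCoeff, if_neg h1, e2Coeff, if_neg h2]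
  push_cast; ring

theorem E22_expansion : HasFourierExpansion E22 0 (eisCoeff 2) := by
  convert hasFourierExpansion_eis (N := 2) two_pos using 2 with τ
  rw [E22]; push_cast; ring

theorem E24_expansion : HasFourierExpansion E24 0 (eisCoeff 4) := by
  convert hasFourierExpansion_eis (N := 4) (by norm_num) using 2 with τ
  rw [E24]; push_cast; ring

/-- The coefficients of `E_1^{(3)}`. -/
noncomputable def e13Coeff (n : ℕ) : ℝ :=
  if n = 0 then 1 else 6 * ((∑ d ∈ n.divisors, legendreSym 3 (d : ℤ) : ℤ) : ℝ)

theorem e13Coeff_nonneg (n : ℕ) : 0 ≤ e13Coeff n := by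
  rw [e13Coeff]
  split_ifs
  · exact zero_le_one
  · exact mul_nonneg (by norm_num) (by exact_mod_cast sum_divisors_legendreSym_nonneg n)

theorem sum_divisors_legendreSym_le (n : ℕ) :
    ∑ d ∈ n.divisors, legendreSym 3 (d : ℤ) ≤ n := by
  calc ∑ d ∈ n.divisors, legendreSym 3 (d : ℤ) ≤ ∑ d ∈ n.divisors, (1 : ℤ) := by
        refine Finset.sum_le_sum fun d _ => ?_
        rw [legendreSym_three]
        split_ifs <;> omega
    _ = n.divisors.card := by simp
    _ ≤ n := by exact_mod_cast Nat.card_divisors_le_self n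

theorem E13_expansion : HasFourierExpansion E13 0 e13Coeff := by
  refine hasFourierExpansion_of_hasSum (S := E13) (fun τ => ?_) fun τ => by simp
  -- Needed because the defining `tsum` would be 0 without convergence; the crude bound by n is
  -- enough.
  have hs : Summable fun n : ℕ => ((∑ d ∈ (n + 1).divisors, legendreSym 3 (d : ℤ) : ℤ) : ℂ) *
      Complex.exp (2 * Real.pi * Complex.I * ((n : ℂ) + 1) * (τ : ℂ)) := by
    have h1 := (hasSum_coe_mul_geometric_of_norm_lt_one (norm_nome_lt_one τ)).summable.norm
    have h2 := (summable_nat_add_iff 1).mpr h1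
    refine Summable.of_norm_bounded h2 fun n => ?_
    have e : Complex.exp (2 * Real.pi * Complex.I * ((n : ℂ) + 1) * (τ : ℂ)) = nome τ ^ (n + 1) := by
      rw [nome, ← Complex.exp_nat_mul]; congr 1; push_cast; ring
    rw [e, norm_mul, norm_mul]
    refine mul_le_mul_of_nonneg_right ?_ (norm_nonneg _)
    rw [Complex.norm_intCast, Complex.norm_natCast, abs_of_nonneg
      (by exact_mod_cast sum_divisors_legendreSym_nonneg (n + 1))]
    exact_mod_cast sum_divisors_legendreSym_le (n + 1)
  rw [← hasSum_nat_add_iff' 1]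
  have h := hs.hasSum.mul_left (6 : ℂ)
  have e0 : E13 τ - ∑ i ∈ range 1, (e13Coeff i : ℂ) * nome τ ^ i =
      6 * ∑' n : ℕ, ((∑ d ∈ (n + 1).divisors, legendreSym 3 (d : ℤ) : ℤ) : ℂ) *
      Complex.exp (2 * Real.pi * Complex.I * ((n : ℂ) + 1) * (τ : ℂ)) := by
    simp [E13, e13Coeff]
  rw [e0]
  refine h.congr_fun fun n => ?_
  rw [e13Coeff, if_neg (Nat.succ_ne_zero n), nome, ← Complex.exp_nat_mul, Complex.ofReal_mul,
    Complex.ofReal_intCast, mul_assoc]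
  congr 3
  push_cast; ring

end KanekoKoike

/-! ### Positivity of the solutions at levels 2, 3 and 4. -/

namespace KanekoKoike

open Finset
open scoped UpperHalfPlane

theorem Delta42_expands : ∃ p : PowerSeries ℝ, CoeffNonneg p ∧ PowerSeries.coeff 0 p = 0 ∧
    Expands Delta42 0 p :=
  ⟨_, CoeffNonneg.X_mul (CoeffNonneg.pow (fun m => by rw [PowerSeries.coeff_mk]; positivity) 2),
    PowerSeries.coeff_zero_X_mul _,
    Expands.shift ((Delta42Root_expands.pow 2).of_eq (fun τ => (Delta42Root_pow τ).symm)
      (by norm_num))⟩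

theorem Delta33_expands : ∃ p : PowerSeries ℝ, CoeffNonneg p ∧ PowerSeries.coeff 0 p = 0 ∧
    Expands Delta33 0 p :=
  ⟨_, CoeffNonneg.X_mul (CoeffNonneg.pow (fun m => by
      rw [PowerSeries.coeff_mk]
      exact_mod_cast sum_divisors_legendreSym_nonneg _) 3),
    PowerSeries.coeff_zero_X_mul _,
    Expands.shift ((Delta33Root_expands.pow 3).of_eq (fun τ => (Delta33Root_pow τ).symm)
      (by norm_num))⟩

theorem solTwo_expansion (k : ℕ) (hk : k % 6 = 2) :
    ∃ c : ℕ → ℝ, HasFourierExpansion (solTwo k) (((k : ℝ) + 1) / 6) c ∧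
      c 0 = 1 ∧ ∀ m, 0 < c m := by
  obtain ⟨n, rfl⟩ : ∃ n, k = 6 * n + 2 := ⟨k / 6, by omega⟩
  obtain ⟨Dp, hD, hD0, hDe⟩ := Delta42_expands
  set P : PowerSeries ℝ := PowerSeries.mk fun m => (ArithmeticFunction.sigma 1 (2 * m + 1) : ℝ)
  have hP : CoeffPos P := fun m => by
    rw [PowerSeries.coeff_mk]
    exact_mod_cast ArithmeticFunction.sigma_pos 1 (2 * m + 1) (by omega)
  have hP0 : PowerSeries.coeff 0 P = 1 := by simp [P]
  set a : ℕ → ℝ := fun i => ordinaryHypergeometricCoefficient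
    (-(((6 * n + 2 : ℕ) : ℝ) - 2) / 12) (-(((6 * n + 2 : ℕ) : ℝ) - 8) / 12)
      ((((6 * n + 2 : ℕ) : ℝ) + 7) / 6) i * 64 ^ i
  have hE := E22_expansion.expands
  have hE0 : PowerSeries.coeff 0 (PowerSeries.mk (eisCoeff 2)) = 1 := by
    rw [PowerSeries.coeff_mk, eisCoeff_zero le_rfl]
  have hEn : CoeffNonneg (PowerSeries.mk (eisCoeff 2)) := fun m => by
    rw [PowerSeries.coeff_mk]; exact (eisCoeff_pos le_rfl m).le
  have ha0 : a 0 = 1 := by simp only [a, hypCoeff_zero_right, pow_zero, mul_one]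
  have hN : (6 * n + 2 - 2) / 12 + 1 = n / 2 + 1 := by omega
  have ha : ∀ i < n / 2 + 1, 0 ≤ a i := fun i hi => by
    -- The numerator parameters are -n/2 and -(n-1)/2, so no factor met before index i is positive.
    have key : ∀ j < i, (j : ℝ) ≤ n / 2 - 1 := fun j hj => by
      have : 2 * j + 2 ≤ n := by omega
      have : 2 * (j : ℝ) + 2 ≤ n := by exact_mod_cast this
      linarith
    refine mul_nonneg (hypCoeff_nonneg (fun j hj => ?_) (fun j hj => ?_) (by positivity))
      (by positivity)
    · have := key j hj
      push_cast; linarith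
    · have := key j hj
      push_cast; linarith
  have h := ((Delta42Root_expands.pow (2 * n + 1)).sum_mul_pow hDe hE a (fun i => n - 2 * i)
    (n / 2 + 1)).of_eq (g := solTwo (6 * n + 2)) (s := (((6 * n + 2 : ℕ) : ℝ) + 1) / 6)
    (fun τ => ?_) (by push_cast; ring)
  · refine ⟨_, h, coeff_zero_mul (coeff_zero_pow hP0 _) (coeff_zero_sum hD0 hE0 ha0 _ _), ?_⟩
    rw [pow_succ', mul_assoc]
    exact hP.mul ((hP.nonneg.pow _).mul (coeffNonneg_sum hD hEn ha _))
      (coeff_zero_mul (coeff_zero_pow hP0 _) (coeff_zero_sum hD0 hE0 ha0 _ _))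
  · rw [solTwo, hN]
    refine Finset.sum_congr rfl fun i _ => ?_
    have e1 : (6 * n + 2 + 1) / 3 = 2 * n + 1 := by omega
    have e2 : (6 * n + 2 - 2) / 6 = n := by omega
    rw [e1, e2, hypCoeff]
    simp only [a]
    push_cast
    rfl

theorem solThree_expansion (k : ℕ) (hk : k % 6 = 1 ∨ k % 6 = 3) :
    ∃ c : ℕ → ℝ, HasFourierExpansion (solThree k) (((k : ℝ) + 1) / 6) c ∧
      c 0 = 1 ∧ (∀ m, 0 ≤ c m) ∧ (k ≠ 1 → ∀ m, 0 < c m) := by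
  obtain ⟨Dp, hD, hD0, hDe⟩ := Delta33_expands
  obtain ⟨Q, hQ, hQ0, hQe⟩ := Delta33Root_sq_expands
  set P : PowerSeries ℝ := PowerSeries.mk fun m =>
      ((∑ d ∈ (3 * m + 1).divisors, legendreSym 3 (d : ℤ) : ℤ) : ℝ)
  have hP : CoeffNonneg P := fun m => by
    rw [PowerSeries.coeff_mk]
    exact_mod_cast sum_divisors_legendreSym_nonneg _
  have hP0 : PowerSeries.coeff 0 P = 1 := by simp [P]
  set a : ℕ → ℝ := fun i => ordinaryHypergeometricCoefficient
    (-((k : ℝ) - 1) / 6) (-((k : ℝ) - 3) / 6) (((k : ℝ) + 7) / 6) i * 27 ^ i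
  have hE := E13_expansion.expands
  have hE0 : PowerSeries.coeff 0 (PowerSeries.mk e13Coeff) = 1 := by
    rw [PowerSeries.coeff_mk, e13Coeff, if_pos rfl]
  have hEn : CoeffNonneg (PowerSeries.mk e13Coeff) := fun m => by
    rw [PowerSeries.coeff_mk]; exact e13Coeff_nonneg m
  have ha0 : a 0 = 1 := by simp only [a, hypCoeff_zero_right, pow_zero, mul_one]
  have ha : ∀ i < (k - 1) / 6 + 1, 0 ≤ a i := fun i hi => by
    have key : ∀ j < i, (j : ℝ) ≤ ((k : ℝ) - 3) / 6 := fun j hj => by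
      have : 6 * j + 3 ≤ k := by omega
      have : 6 * (j : ℝ) + 3 ≤ k := by exact_mod_cast this
      linarith
    refine mul_nonneg (hypCoeff_nonneg (fun j hj => ?_) (fun j hj => ?_) (by positivity))
      (by positivity)
    · have := key j hj
      linarith
    · have := key j hj
      linarith
  have hsol : ∀ τ, solThree k τ = ∑ i ∈ range ((k - 1) / 6 + 1),
      (a i : ℂ) * (Delta33Root τ ^ ((k + 1) / 2) * Delta33 τ ^ i) *
        E13 τ ^ ((k - 1) / 2 - 3 * i) := fun τ => by
    rw [solThree]
    refine Finset.sum_congr rfl fun i _ => ?_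
    rw [hypCoeff]
    simp only [a]
    push_cast
    rfl
  have hk2 : (((k + 1) / 2 : ℕ) : ℝ) = ((k : ℝ) + 1) / 2 := by
    rw [eq_div_iff two_ne_zero]
    have : (k + 1) / 2 * 2 = k + 1 := by omega
    exact_mod_cast this
  by_cases hk1 : k = 1
  · have h := ((Delta33Root_expands.pow ((k + 1) / 2)).sum_mul_pow hDe hE a
      (fun i => (k - 1) / 2 - 3 * i) ((k - 1) / 6 + 1)).of_eq hsol
      (s := ((k : ℝ) + 1) / 6) (by rw [hk2]; ring)
    exact ⟨_, h, coeff_zero_mul (coeff_zero_pow hP0 _) (coeff_zero_sum hD0 hE0 ha0 _ _),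
      (hP.pow _).mul (coeffNonneg_sum hD hEn ha _), fun h => absurd hk1 h⟩
  -- For k ≥ 3 the root occurs with exponent at least 2, so its strictly positive square can be
  -- split off.
  · have hR := (hQe.mul (Delta33Root_expands.pow ((k + 1) / 2 - 2))).of_eq
      (g := fun τ => Delta33Root τ ^ ((k + 1) / 2)) (s := ((k : ℝ) + 1) / 6)
      (fun τ => by rw [← pow_add]; congr 1; omega)
      (by rw [Nat.cast_sub (by omega), hk2]; push_cast; ring)
    have h := (hR.sum_mul_pow hDe hE a
      (fun i => (k - 1) / 2 - 3 * i) ((k - 1) / 6 + 1)).of_eq hsol rfl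
    rw [mul_assoc] at h
    have hpos := hQ.mul ((hP.pow ((k + 1) / 2 - 2)).mul
      (coeffNonneg_sum hD hEn ha fun i => (k - 1) / 2 - 3 * i))
      (coeff_zero_mul (coeff_zero_pow hP0 _) (coeff_zero_sum hD0 hE0 ha0 _ _))
    exact ⟨_, h, coeff_zero_mul hQ0 (coeff_zero_mul (coeff_zero_pow hP0 _)
      (coeff_zero_sum hD0 hE0 ha0 _ _)), hpos.nonneg, fun _ => hpos⟩

theorem E24_sub_expansion (α : ℝ) : HasFourierExpansion
    (fun τ => E24 τ - (α : ℂ) * Delta24 τ) 0 fun n => eisCoeff 4 n - α * oddSigma n := by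
  intro τ
  refine ((E24_expansion τ).sub ((Delta24_expansion τ).mul_left (α : ℂ))).congr_fun fun n => ?_
  push_cast; ring

theorem oddSigma_nonneg (n : ℕ) : 0 ≤ oddSigma n := by
  rw [oddSigma]; split_ifs <;> positivity

theorem eisCoeff_sub_oddSigma_pos {α : ℝ} (hα : α < 8) (n : ℕ) :
    0 < eisCoeff 4 n - α * oddSigma n := by
  by_cases hn : Odd n
  · rw [eisCoeff_four_of_odd hn, oddSigma, if_pos hn]
    have : (0 : ℝ) < ArithmeticFunction.sigma 1 n := by
      exact_mod_cast ArithmeticFunction.sigma_pos 1 n hn.pos.ne'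
    nlinarith
  · rw [oddSigma, if_neg hn, mul_zero, sub_zero]
    exact eisCoeff_pos (by norm_num) n

theorem eisCoeff_sub_eight_oddSigma_nonneg (n : ℕ) : 0 ≤ eisCoeff 4 n - 8 * oddSigma n := by
  by_cases hn : Odd n
  · rw [eisCoeff_four_of_odd hn, oddSigma, if_pos hn, sub_self]
  · rw [oddSigma, if_neg hn, mul_zero, sub_zero]
    exact (eisCoeff_pos (by norm_num) n).le

theorem solFour_expansion (n : ℕ) :
    ∃ c : ℕ → ℝ, HasFourierExpansion (solFour n) ((2 * (n : ℝ) + 1) / 4) c ∧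
      c 0 = 1 ∧ (∀ m, 0 ≤ c m) ∧ (n ≠ 0 → ∀ m, 0 < c m) := by
  obtain ⟨P, hP, hP0, hPe⟩ := Delta24Root_expands
  have hn0 : (0 : ℝ) ≤ n := n.cast_nonneg
  -- These are -(k-2)/6 and (k+7)/6 at k = 3n + 1/2; then c - 2b = 3n/2 + 3/4 is positive.
  obtain ⟨s, hs, hs0, hsum⟩ := exists_pos_reexpansion (b := 1 / 4 - n / 2) (c := n / 2 + 5 / 4)
    (by positivity) (by linarith) n
  set a : ℕ → ℝ := fun j => n.choose j * s j * 8 ^ j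
  have ha0 : a 0 = 1 := by simp [a, hs0]
  have ha : ∀ j, 0 ≤ a j := fun j => by have := hs j; positivity
  set D := PowerSeries.mk oddSigma
  set H := PowerSeries.mk fun m => eisCoeff 4 m - 8 * oddSigma m
  have hDe : Expands Delta24 0 D := Delta24_expansion.expands
  have hHe : Expands (fun τ => E24 τ - ((8 : ℝ) : ℂ) * Delta24 τ) 0 H :=
    (E24_sub_expansion 8).expands
  have hD : CoeffNonneg D := fun m => by rw [PowerSeries.coeff_mk]; exact oddSigma_nonneg m
  have hH : CoeffNonneg H := fun m => by
    rw [PowerSeries.coeff_mk]; exact eisCoeff_sub_eight_oddSigma_nonneg m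
  have hD0 : PowerSeries.coeff 0 D = 0 := by simp [D, oddSigma]
  have hH0 : PowerSeries.coeff 0 H = 1 := by
    simp [H, oddSigma, eisCoeff_zero (show 2 ≤ 4 by norm_num)]
  have hG := coeffNonneg_sum hD hH (N := n + 1) (fun j _ => ha j) fun j => n - j
  have hG0 := coeff_zero_sum hD0 hH0 ha0 (fun j => n - j) n
  have h := ((hPe.pow (2 * n + 1)).sum_mul_pow hDe hHe a (fun j => n - j)
    (n + 1)).of_eq (g := solFour n) (s := (2 * (n : ℝ) + 1) / 4) (fun τ => ?_) (by push_cast; ring)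
  · refine ⟨_, h, coeff_zero_mul (coeff_zero_pow hP0 _) hG0, (hP.pow _).mul hG, fun hn => ?_⟩
    obtain ⟨m, rfl⟩ := Nat.exists_eq_succ_of_ne_zero hn
    rw [mul_comm]
    refine CoeffPos.mul ?_ (hP.pow _) (coeff_zero_pow hP0 _)
    -- The terms j = 0 and j = 1 are isolated: together they are (a₁Δ + H) H^(n-1), and the rest is
    -- nonnegative.
    rw [Finset.sum_range_succ', Finset.sum_range_succ', add_assoc, add_comm]
    refine CoeffPos.add_nonneg ?_ (CoeffNonneg.sum fun i _ =>
      ((hD.pow _).mul (hH.pow _)).C_mul (ha _))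
    have e : PowerSeries.C (a (0 + 1)) * (D ^ (0 + 1) * H ^ (m.succ - (0 + 1))) +
        PowerSeries.C (a 0) * (D ^ 0 * H ^ (m.succ - 0)) =
        (PowerSeries.C (a 1) * D + H) * H ^ m := by
      rw [ha0, map_one, zero_add, pow_one, pow_zero, Nat.sub_zero, Nat.succ_sub_one, pow_succ]
      ring
    rw [e]
    refine CoeffPos.mul (fun i => ?_) (hH.pow _) (coeff_zero_pow hH0 _)
    have ha1 : 0 < a 1 := by
      have := hs 1
      simp only [a, Nat.choose_one_right]
      positivity
    rw [map_add, PowerSeries.coeff_C_mul, PowerSeries.coeff_mk, PowerSeries.coeff_mk]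
    -- H + a₁Δ equals E - (8 - a₁)Δ, and a₁ > 0 puts the parameter below 8.
    have h1 := eisCoeff_sub_oddSigma_pos (α := 8 - a 1) (by linarith) i
    linarith
  -- With w = 8Δ, the quantity 2w matches the 16Δ in the definition and H + w is the Eisenstein
  -- series.
  · have hw := hsum (E24 τ - ((8 : ℝ) : ℂ) * Delta24 τ) (8 * Delta24 τ)
    have e1 : E24 τ - ((8 : ℝ) : ℂ) * Delta24 τ + 8 * Delta24 τ = E24 τ := by push_cast; ring
    rw [e1] at hw
    have e2 : solFour n τ = Delta24Root τ ^ (2 * n + 1) * ∑ i ∈ range (n + 1),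
        hypCoeff (-(n : ℝ)) (1 / 4 - n / 2) (n / 2 + 5 / 4) i * (2 * (8 * Delta24 τ)) ^ i *
          E24 τ ^ (n - i) := by
      rw [solFour, Finset.mul_sum]
      refine Finset.sum_congr rfl fun i _ => ?_
      have f1 : -(2 * (3 * (n : ℝ) + 1 / 2) - 1) / 6 = -n := by ring
      have f2 : -(3 * (n : ℝ) + 1 / 2 - 2) / 6 = 1 / 4 - n / 2 := by ring
      have f3 : (3 * (n : ℝ) + 1 / 2 + 7) / 6 = n / 2 + 5 / 4 := by ring
      rw [f1, f2, f3, ← mul_assoc 2 8, mul_pow]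
      norm_num
      ring
    rw [e2, hw, Finset.mul_sum]
    refine Finset.sum_congr rfl fun j _ => ?_
    simp only [a]
    push_cast
    rw [mul_pow]
    ring

end KanekoKoike

theorem theorem3 :
    (∀ k : ℕ, k % 6 = 2 →
      ∃ c : ℕ → ℝ, KanekoKoike.HasFourierExpansion (KanekoKoike.solTwo k) (((k : ℝ) + 1) / 6) c ∧
        c 0 = 1 ∧ ∀ m, 0 < c m) ∧
    (∀ k : ℕ, k % 6 = 1 ∨ k % 6 = 3 →
      ∃ c : ℕ → ℝ, KanekoKoike.HasFourierExpansion (KanekoKoike.solThree k) (((k : ℝ) + 1) / 6) c ∧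
        c 0 = 1 ∧ (∀ m, 0 ≤ c m) ∧ (k ≠ 1 → ∀ m, 0 < c m)) ∧
    (∀ (k : ℝ) (n : ℕ), k = 3 * (n : ℝ) + 1 / 2 →
      ∃ c : ℕ → ℝ, KanekoKoike.HasFourierExpansion (KanekoKoike.solFour n) ((k + 1) / 6) c ∧
        c 0 = 1 ∧ (∀ m, 0 ≤ c m) ∧ (k ≠ 1 / 2 → ∀ m, 0 < c m)) ∧
    (∀ α : ℝ, 0 ≤ α → α < 8 →
      ∃ c : ℕ → ℝ, KanekoKoike.HasFourierExpansion
        (fun τ => KanekoKoike.E24 τ - (α : ℂ) * KanekoKoike.Delta24 τ) 0 c ∧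
        ∀ m, 0 < c m) := by
  refine ⟨KanekoKoike.solTwo_expansion, KanekoKoike.solThree_expansion, ?_, fun α _ hα =>
    ⟨_, KanekoKoike.E24_sub_expansion α, KanekoKoike.eisCoeff_sub_oddSigma_pos hα⟩⟩
  rintro k n rfl
  obtain ⟨c, h, h0, hn, hp⟩ := KanekoKoike.solFour_expansion n
  refine ⟨c, ?_, h0, hn, fun hk => hp ?_⟩
  · have e : (3 * (n : ℝ) + 1 / 2 + 1) / 6 = (2 * n + 1) / 4 := by ring
    rwa [e]
  · rintro rfl
    simp at hk
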